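/- **Setting.** For $n\ge 1$ consider convex finite-sum coupled compositional (cFCCO) problems $$\min_{x\in\mathcal X}F(x),\qquad F(x)=\frac1n\sum_{i=1}^n f_i(g_i(x))+r(x),\qquad g_i(x)=\mathbb E_{\zeta\sim\mathbb P_i}[g_i(x;\zeta)],$$ where $\mathcal X\subseteq\mathbb R^d$ is closed and convex with $0\in\mathcal X$; $r$ is lower semicontinuous and $\mu$-strongly convex on $\mathcal X$ (merely convex if $\mu=0$); $g_i:\mathbb R^d\to\mathbb R$ is convex, differentiable and $C_g$-Lipschitz, with $g_i(\cdot;\zeta)$ differentiable; $f_i:\mathbb R\to\mathbb R$ is convex and $C_f$-Lipschitz, and non-decreasing unless $g_i$ is affine; and, for all $x$ and all $y$ with $y_i\in\mathrm{dom} f_i^*$, $$\mathbb E|g_i(x)-g_i(x;\zeta)|^2\le\sigma_0^2,\quad \mathbb E\|\nabla g_i(x)-\nabla g_i(x;\zeta)\|^2\le\sigma_1^2,\quad \frac1n\sum_{j}\Big\|y_j\nabla g_j(x)-\frac1n\sum_i y_i\nabla g_i(x)\Big\|^2\le\delta^2 .$$ **Abstract scheme.** Fix $\tau,\eta>0$ and,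 for each $i$, a function $\psi_i$ that is strictly convex on its effective domain, with Bregman divergence $U_{\psi_i}$ formed with subgradients of $\psi_i$. The scheme maintains linear spaces $\mathfrak g_t^{(i)},\mathfrak Y_t^{(i)}\subseteq\mathbb R$ ($i\le n$) and $\mathfrak G_t,\mathfrak X_t\subseteq\mathbb R^d$, all equal to $\{0\}$ at $t=0$. In iteration $t$ it samples a batch $\mathcal S_t\subseteq\{1,\dots,n\}$ with $|\mathcal S_t|=S$ and $\zeta_t^{(i)},\tilde\zeta_t^{(i)}$ i.i.d. from $\mathbb P_i$, the batch being independent of $(\zeta_t^{(i)},\tilde\zeta_t^{(i)})$ for each $i$ (the joint law across blocks and across iterations is otherwise arbitrary). For $i\in\mathcal S_t$, $$\mathfrak g_{t+1}^{(i)}=\mathfrak g_t^{(i)}+\mathrm{span}\{g_i(\hat x;\zeta_t^{(i)}):\hat x\in\mathfrak X_t\},\qquad \mathfrak Y_{t+1}^{(i)}=\mathfrak Y_t^{(i)}+\mathrm{span}\{\mathrm{MP}_i(\hat y,\hat g):\hat y\in\mathfrak Y_t^{(i)},\hat g\in\mathfrak g_{t+1}^{(i)}\},$$ $\mathrm{MP}_i(\hat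 y,\hat g)=\arg\max_v\{v\hat g-f_i^*(v)-\tau U_{\psi_i}(v,\hat y)\}$; for $i\notin\mathcal S_t$ these two spaces do not change. Then $$\mathfrak G_{t+1}=\mathfrak G_t+\mathrm{span}\Big\{\frac1S\sum_{i\in\mathcal S_t}\hat y^{(i)}\nabla g_i(\hat x;\tilde\zeta_t^{(i)}):\hat x\in\mathfrak X_t,\ \hat y^{(i)}\in\mathfrak Y_{t+1}^{(i)}\Big\},$$ $$\mathfrak X_{t+1}=\mathfrak X_t+\mathrm{span}\Big\{\arg\min_{x\in\mathcal X}\{x^\top\hat G+r(x)+\tfrac\eta2\|x-\hat x\|^2\}:\hat x\in\mathfrak X_t,\ \hat G\in\mathfrak G_{t+1}\Big\}.$$ After $T$ iterations ($ST$ oracle calls) an algorithm in the scheme outputs any random vector $\bar x$ with $\bar x\in\mathfrak X_T$ almost surely. **Theorem.** Let $C_f,C_g,\sigma_0,\delta>0$ and $\sigma_1\ge0$. There is a constant $c>0$, depending only on these, such that for all integers $1\le S\le n$ the following hold. 1. (*Smooth $f_i$, strongly convex problem.*) Let $\mu,L_f,\epsilon>0$ with $n\mu\le\max\{1,L_f^2\}$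 and $\epsilon(1+n\mu)\le c$. There are a $d$ and a problem of the above class on $\mathbb R^d$, with strong convexity modulus $\mu$, all $f_i$ $L_f$-smooth, and minimizer $x_*$, for which every algorithm in the abstract scheme (any $\tau,\eta,\psi_i$, any sampling as above, any $T$, any output) with $\frac\mu2\mathbb E\|\bar x-x_*\|^2\le\epsilon$ makes at least $c\max\{\frac S\mu,n\}\,\epsilon^{-1}$ oracle calls. Moreover, with only $\epsilon\mu\le c$ in place of the two restrictions on $n\mu$, there is such a problem requiring at least $c\,\frac S\mu\,\epsilon^{-1}$ oracle calls. 2. (*Non-smooth $f_i$, merely or strongly convex problem.*) Let $\mu\ge0$ and $\epsilon>0$ with $\epsilon(1+n\mu)\le c$. There are a $d$ and a problem of the above class on $\mathbb R^d$, with modulus $\mu$, no $f_i$ differentiable on all of $\mathbb R$, and a minimizer $x_*$, for which every algorithm in the abstract scheme whose output satisfies $\bar x\in\mathcal X$ almost surely and $\mathbb E[F(\bar x)-F(x_*)]\le\epsilon$ makes at least $c\,n\,\epsilon^{-2}$ oracle calls. -/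

import Mathlib

open MeasureTheory ProbabilityTheory

universe u

/-- The data of a finite-sum coupled compositional problem with `n` blocks on `ℝ^d`,
`min_{x ∈ X} F(x)`, `F(x) = (1/n) ∑ i, f i (E_{ζ ∼ P i} [g i x ζ]) + r x`,
with scalar inner functions. -/
structure CFCCO (n d : ℕ) where
  /-- the feasible set -/
  X : Set (EuclideanSpace ℝ (Fin d))
  /-- the regularizer -/
  r : EuclideanSpace ℝ (Fin d) → ℝ
  /-- the outer functions -/
  f : Fin n → ℝ → ℝ
  /-- the sample space of the stochastic oracles -/
  Z : Type
  mZ : MeasurableSpace Z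
  /-- the sampling distributions -/
  P : Fin n → @Measure Z mZ
  /-- the stochastic inner functions `g i x ζ` -/
  g : Fin n → EuclideanSpace ℝ (Fin d) → Z → ℝ

attribute [instance] CFCCO.mZ

/-- The effective domain of the convex conjugate of `f : ℝ → ℝ`. -/
def conjDom (f : ℝ → ℝ) : Set ℝ := {v | BddAbove (Set.range fun u : ℝ => v * u - f u)}

/-- The convex conjugate `f^*(v) = sup_u (v u - f u)`; only used for `v ∈ conjDom f`. -/
noncomputable def fenchelConj (f : ℝ → ℝ) (v : ℝ) : ℝ := ⨆ u : ℝ, (v * u - f u)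

/-- `f` is differentiable and `L`-smooth. -/
def OuterSmooth (f : ℝ → ℝ) (L : ℝ) : Prop :=
  Differentiable ℝ f ∧
    ∀ u v : ℝ, |f u - f v - deriv f v * (u - v)| ≤ L / 2 * (u - v) ^ 2

namespace CFCCO

variable {n d : ℕ}

/-- The inner function `g_i(x) = E_{ζ ∼ P i} [g i x ζ]`. -/
noncomputable def mean (p : CFCCO n d) (i : Fin n) (x : EuclideanSpace ℝ (Fin d)) : ℝ :=
  ∫ z, p.g i x z ∂(p.P i)

/-- The objective function `F`. -/
noncomputable def F (p : CFCCO n d) (x : EuclideanSpace ℝ (Fin d)) : ℝ :=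
  (1 / (n : ℝ)) * ∑ i, p.f i (p.mean i x) + p.r x

/-- `xs` minimizes `F` over the feasible set. -/
def IsMinimizer (p : CFCCO n d) (xs : EuclideanSpace ℝ (Fin d)) : Prop :=
  xs ∈ p.X ∧ IsMinOn p.F p.X xs

/-- `p` is a convex problem of the class with strong convexity modulus `μ` (`μ = 0`: merely
convex), Lipschitz constants `Cf`, `Cg` and variance bounds `σ0 ^ 2`, `σ1 ^ 2`, `δ ^ 2`.
The inner functions are defined, and the requirements on them are imposed, on all of `ℝ^d`. -/
structure InClass (p : CFCCO n d) (Cf Cg σ0 σ1 δ μ : ℝ) : Prop where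
  -- feasible set and regularizer
  X_closed : IsClosed p.X
  X_convex : Convex ℝ p.X
  X_zero : (0 : EuclideanSpace ℝ (Fin d)) ∈ p.X
  r_lsc : LowerSemicontinuousOn p.r p.X
  r_convex : StrongConvexOn p.X μ p.r
  -- stochastic inner functions
  prob : ∀ i, IsProbabilityMeasure (p.P i)
  g_integrable : ∀ i x, Integrable (p.g i x) (p.P i)
  g_diff : ∀ i z, Differentiable ℝ (fun x => p.g i x z)
  -- inner functions
  mean_diff : ∀ i, Differentiable ℝ (p.mean i)
  mean_convex : ∀ i, ConvexOn ℝ Set.univ (p.mean i)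
  mean_lip : ∀ i x x', |p.mean i x - p.mean i x'| ≤ Cg * ‖x - x'‖
  -- outer functions
  f_convex : ∀ i, ConvexOn ℝ Set.univ (p.f i)
  f_lip : ∀ i u u', |p.f i u - p.f i u'| ≤ Cf * |u - u'|
  f_mono : ∀ i, (∃ (a : EuclideanSpace ℝ (Fin d) →L[ℝ] ℝ) (b : ℝ), ∀ x, p.mean i x = a x + b) ∨
    Monotone (p.f i)
  -- variances of the zeroth-order and first-order oracles, and variability of the blocks
  var_zero : ∀ i x, ∫⁻ z, ENNReal.ofReal ((p.mean i x - p.g i x z) ^ 2) ∂(p.P i)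
    ≤ ENNReal.ofReal (σ0 ^ 2)
  var_one : ∀ i x, ∫⁻ z, ENNReal.ofReal
      (‖gradient (p.mean i) x - gradient (fun x' => p.g i x' z) x‖ ^ 2) ∂(p.P i)
    ≤ ENNReal.ofReal (σ1 ^ 2)
  var_block : ∀ (x : EuclideanSpace ℝ (Fin d)) (y : Fin n → ℝ), (∀ i, y i ∈ conjDom (p.f i)) →
    (1 / (n : ℝ)) * ∑ j, ‖y j • gradient (p.mean j) x
      - (1 / (n : ℝ)) • ∑ i, y i • gradient (p.mean i) x‖ ^ 2 ≤ δ ^ 2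

end CFCCO

/-- A distance-generating function: strictly convex on its effective domain `dom`
(a function that is finite on all of `ℝ` has `dom = univ`; `f^*` is allowed when it is
strictly convex on its effective domain). -/
structure DistGen where
  dom : Set ℝ
  fn : ℝ → ℝ
  strict : StrictConvexOn ℝ dom fn

namespace DistGen

/-- `q` is a subgradient of `ψ` at `v`. -/
def IsSubgrad (ψ : DistGen) (v q : ℝ) : Prop :=
  v ∈ ψ.dom ∧ ∀ w ∈ ψ.dom, ψ.fn v + q * (w - v) ≤ ψ.fn w

/-- The Bregman divergence `U_ψ(u, v)` formed with the subgradient `q` of `ψ` at `v`. -/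
def bregman (ψ : DistGen) (q u v : ℝ) : ℝ := ψ.fn u - ψ.fn v - q * (u - v)

end DistGen

/-- `v` is a value of the mirror-prox map
`MP(y, γ) = argmax_v {v γ - f^*(v) - τ U_ψ(v, y)}`. -/
def IsMP (f : ℝ → ℝ) (ψ : DistGen) (τ y γ v : ℝ) : Prop :=
  ∃ q : ℝ, ψ.IsSubgrad y q ∧ v ∈ conjDom f ∩ ψ.dom ∧
    IsMaxOn (fun w => w * γ - fenchelConj f w - τ * ψ.bregman q w y) (conjDom f ∩ ψ.dom) v

/-- `x` is a value of the proximal map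
`QP(x₀, G) = argmin_{x ∈ X} {⟨x, G⟩ + r(x) + (η/2) ‖x - x₀‖²}`. -/
def CFCCO.IsQP {n d : ℕ} (p : CFCCO n d) (η : ℝ) (x₀ G x : EuclideanSpace ℝ (Fin d)) : Prop :=
  x ∈ p.X ∧ IsMinOn (fun w => inner ℝ w G + p.r w + η / 2 * ‖w - x₀‖ ^ 2) p.X x

/-- The spaces maintained by the abstract scheme: the slices of the spaces of inner values and of
dual variables, the space of gradient estimators, and the primal space. -/
structure Spaces (n d : ℕ) where
  inn : Fin n → Submodule ℝ ℝ
  dual : Fin n → Submodule ℝ ℝ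
  grad : Submodule ℝ (EuclideanSpace ℝ (Fin d))
  primal : Submodule ℝ (EuclideanSpace ℝ (Fin d))

namespace Spaces

variable {n d : ℕ}

/-- All spaces are zero at the start. -/
def init (n d : ℕ) : Spaces n d := ⟨fun _ => ⊥, fun _ => ⊥, ⊥, ⊥⟩

open Classical in
/-- The slices of the space of inner values after an iteration with batch `B` and samples `z`. -/
noncomputable def nextInn (p : CFCCO n d) (B : Finset (Fin n)) (z : Fin n → p.Z)
    (s : Spaces n d) (i : Fin n) : Submodule ℝ ℝ :=
  if i ∈ B then s.inn i ⊔ Submodule.span ℝ {u | ∃ x ∈ s.primal, u = p.g i x (z i)}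
  else s.inn i

open Classical in
/-- The slices of the dual space after an iteration; `inn'` are the new slices of inner values. -/
noncomputable def nextDual (p : CFCCO n d) (τ : ℝ) (ψ : Fin n → DistGen) (B : Finset (Fin n))
    (inn' : Fin n → Submodule ℝ ℝ) (s : Spaces n d) (i : Fin n) : Submodule ℝ ℝ :=
  if i ∈ B then
    s.dual i ⊔ Submodule.span ℝ {v | ∃ y ∈ s.dual i, ∃ γ ∈ inn' i, IsMP (p.f i) (ψ i) τ y γ v}
  else s.dual i

/-- The gradient estimator `G(x, y) = (1/S) ∑_{i ∈ B} y_i ∇g_i(x; z'_i)`. -/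
noncomputable def gradEst (p : CFCCO n d) (B : Finset (Fin n)) (z' : Fin n → p.Z)
    (x : EuclideanSpace ℝ (Fin d)) (y : Fin n → ℝ) : EuclideanSpace ℝ (Fin d) :=
  (1 / (B.card : ℝ)) • ∑ i ∈ B, y i • gradient (fun x' => p.g i x' (z' i)) x

/-- The space of gradient estimators after an iteration; `dual'` are the new dual slices. -/
noncomputable def nextGrad (p : CFCCO n d) (B : Finset (Fin n)) (z' : Fin n → p.Z)
    (dual' : Fin n → Submodule ℝ ℝ) (s : Spaces n d) :
    Submodule ℝ (EuclideanSpace ℝ (Fin d)) :=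
  s.grad ⊔ Submodule.span ℝ
    {G | ∃ x ∈ s.primal, ∃ y : Fin n → ℝ, (∀ i, y i ∈ dual' i) ∧ G = gradEst p B z' x y}

/-- The primal space after an iteration; `grad'` is the new space of gradient estimators. -/
noncomputable def nextPrimal (p : CFCCO n d) (η : ℝ)
    (grad' : Submodule ℝ (EuclideanSpace ℝ (Fin d))) (s : Spaces n d) :
    Submodule ℝ (EuclideanSpace ℝ (Fin d)) :=
  s.primal ⊔ Submodule.span ℝ {x | ∃ x₀ ∈ s.primal, ∃ G ∈ grad', p.IsQP η x₀ G x}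

/-- One iteration of the abstract scheme with batch `B` and samples `z`, `z'`. -/
noncomputable def step (p : CFCCO n d) (τ η : ℝ) (ψ : Fin n → DistGen) (B : Finset (Fin n))
    (z z' : Fin n → p.Z) (s : Spaces n d) : Spaces n d :=
  let inn' := nextInn p B z s
  let dual' := nextDual p τ ψ B inn' s
  let grad' := nextGrad p B z' dual' s
  ⟨inn', dual', grad', nextPrimal p η grad' s⟩

/-- The spaces after `t` iterations, given the sequences of batches and of samples. -/
noncomputable def iter (p : CFCCO n d) (τ η : ℝ) (ψ : Fin n → DistGen)
    (B : ℕ → Finset (Fin n)) (z z' : ℕ → Fin n → p.Z) : ℕ → Spaces n d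
  | 0 => init n d
  | t + 1 => step p τ η ψ (B t) (z t) (z' t) (iter p τ η ψ B z z' t)

end Spaces

/-- The random batches and samples of the abstract scheme. In every iteration `t` the batch has
`S` elements, `ζ t i` and `ζ' t i` are i.i.d. with law `P i`, and the batch is independent of
them. Nothing else is required of the joint law across blocks and iterations, nor that batches be
uniform: sampling everything independently is a special case, and so is sharing a sample between
the blocks. -/
structure Sampling {n d : ℕ} (p : CFCCO n d) (S : ℕ) {Ω : Type u} [MeasurableSpace Ω]
    (Pr : Measure Ω) where
  batch : ℕ → Ω → Finset (Fin n)
  ζ : ℕ → Fin n → Ω → p.Z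
  ζ' : ℕ → Fin n → Ω → p.Z
  batch_meas : ∀ t, Measurable (batch t)
  ζ_meas : ∀ t i, Measurable (ζ t i)
  ζ'_meas : ∀ t i, Measurable (ζ' t i)
  batch_card : ∀ t ω, (batch t ω).card = S
  ζ_law : ∀ t i, Pr.map (ζ t i) = p.P i
  ζ'_law : ∀ t i, Pr.map (ζ' t i) = p.P i
  ζ_indep : ∀ t i, IndepFun (ζ t i) (ζ' t i) Pr
  batch_indep : ∀ t i, IndepFun (batch t) (fun ω => (ζ t i ω, ζ' t i ω)) Pr

/-- The random primal space after `T` iterations of the abstract scheme. -/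
noncomputable def Sampling.primal {n d : ℕ} {p : CFCCO n d} {S : ℕ} {Ω : Type u}
    [MeasurableSpace Ω] {Pr : Measure Ω} (s : Sampling p S Pr) (τ η : ℝ) (ψ : Fin n → DistGen)
    (T : ℕ) (ω : Ω) : Submodule ℝ (EuclideanSpace ℝ (Fin d)) :=
  (Spaces.iter p τ η ψ (fun t => s.batch t ω) (fun t i => s.ζ t i ω) (fun t i => s.ζ' t i ω)
    T).primal

/-- Every algorithm within the abstract scheme with batch size `S` needs at least `N` oracle calls
(`S` in each iteration) on the problem `p` to output a random point `xbar` of the current primal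
space whose expected loss is at most `ε`. Here `loss` is nonnegative on the set `D` of admissible
outputs. The expectation is a Lebesgue integral, so it is meaningful (possibly infinite) for
every measurable `xbar`. -/
def NeedsCalls {n d : ℕ} (p : CFCCO n d) (S : ℕ) (D : Set (EuclideanSpace ℝ (Fin d)))
    (loss : EuclideanSpace ℝ (Fin d) → ℝ) (ε N : ℝ) : Prop :=
  ∀ (τ η : ℝ) (ψ : Fin n → DistGen), 0 < τ → 0 < η →
  ∀ (Ω : Type u) [MeasurableSpace Ω] (Pr : Measure Ω) [IsProbabilityMeasure Pr]
    (s : Sampling p S Pr) (T : ℕ) (xbar : Ω → EuclideanSpace ℝ (Fin d)), Measurable xbar →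
    (∀ᵐ ω ∂Pr, xbar ω ∈ s.primal τ η ψ T ω ∧ xbar ω ∈ D) →
    ∫⁻ ω, ENNReal.ofReal (loss (xbar ω)) ∂Pr ≤ ENNReal.ofReal ε →
    N ≤ (S : ℝ) * (T : ℝ)

/-! Two families of hard instances, both with `X = univ` and quadratic `r`, confine the primal space
to few coordinates. Rare observation (`sparseProblem`): block `i` acts only on `x i`. Its inner
value `a * x i + m` is reported as `a * x i`, except with probability `q`, when it is `a * x i + m /
q`. As long as block `i` is never sampled together with the rare value, all that is known of it
stays at zero: the oracle returns `0`, the mirror step returns `0` because `f` is minimal there, the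
estimator has no `i`-th component, and the proximal step keeps `x i = 0`
(`sparseProblem_coord_eq_zero`). The expected number of rare hits is `T * S * q`, so a small
expected loss forces `S * T ≥ n / (2 * q)` (`sparseProblem_needsCalls`). The variance bound allows
`q` of order `m ^ 2 / σ0 ^ 2`. With `f` a multiple of `max u 0`, a loss of order `ε` needs `m` of
order `ε`, whence `n / ε ^ 2`. With `f` a pseudo-Huber function of curvature `√(n * μ)`, `m` of
order `√ε` suffices, whence `n / ε`. Chain (`chainProblem`): every block carries the same noiseless
smoothed maximum of the shifted coordinates. Its gradient at a point supported on the first `t`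
coordinates is supported on the first `t + 1` (`projOn_mem_headSpace`), so one iteration, costing
`S` calls, gains one coordinate whatever the batch is. All `k` coordinates of the minimizer are
large, hence `k / 2` iterations are needed, with `k` of order `1 / (μ * ε)`. -/

/-! ### Criteria for convexity and gradients, conjugate domains, variance. -/

/-- A function with a supporting affine function at every point is convex. -/
theorem convexOn_univ_of_subgradient {E : Type*} [AddCommGroup E] [Module ℝ E] {f : E → ℝ}
    (D : E → E →ₗ[ℝ] ℝ) (h : ∀ x y, f x + D x (y - x) ≤ f y) : ConvexOn ℝ Set.univ f := by
  refine ⟨convex_univ, fun x _ y _ s t hs ht hst => ?_⟩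
  have hx := mul_le_mul_of_nonneg_left (h (s • x + t • y) x) hs
  have hy := mul_le_mul_of_nonneg_left (h (s • x + t • y) y) ht
  have key : s * D (s • x + t • y) (x - (s • x + t • y))
      + t * D (s • x + t • y) (y - (s • x + t • y)) = 0 := by
    simp only [map_sub, map_add, map_smul, smul_eq_mul]
    linear_combination (- (s * D (s • x + t • y) x + t * D (s • x + t • y) y)) * hst
  simp only [smul_eq_mul]
  have e : f (s • x + t • y) = s * f (s • x + t • y) + t * f (s • x + t • y) := by
    rw [← add_mul, hst, one_mul]
  linarith

/-- A function with a quadratic error bound for its linear approximation at `x` has a gradient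
there. -/
theorem hasGradientAt_of_quadratic_bound {E : Type*} [NormedAddCommGroup E]
    [InnerProductSpace ℝ E] [CompleteSpace E] {f : E → ℝ} {x v : E} (C : ℝ)
    (h : ∀ y, |f y - f x - inner ℝ v (y - x)| ≤ C * ‖y - x‖ ^ 2) : HasGradientAt f v x := by
  rw [hasGradientAt_iff_hasFDerivAt]
  have h0 : HasFDerivAt (fun y => f y - f x - inner ℝ v (y - x)) (0 : E →L[ℝ] ℝ) x := by
    refine Asymptotics.IsBigO.hasFDerivAt (n := 2) ?_ one_lt_two
    refine Asymptotics.IsBigO.of_bound C (Filter.Eventually.of_forall fun y => ?_)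
    simpa using h y
  have h1 : HasFDerivAt (fun y => f x + (InnerProductSpace.toDual ℝ E v) (y - x))
      (InnerProductSpace.toDual ℝ E v) x := by
    have := (((InnerProductSpace.toDual ℝ E v).hasFDerivAt (x := x)).sub_const
      (inner ℝ v x)).const_add (f x)
    simpa only [map_sub, InnerProductSpace.toDual_apply_apply] using this
  have h2 := h0.add h1
  rw [zero_add] at h2
  refine h2.congr_of_eventuallyEq (Filter.Eventually.of_forall fun y => ?_)
  simp [InnerProductSpace.toDual_apply_apply]

/-- The conjugate of a `C`-Lipschitz function is finite only on `[-C, C]`. -/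
theorem abs_le_of_mem_conjDom {f : ℝ → ℝ} {C v : ℝ} (hf : ∀ u u', |f u - f u'| ≤ C * |u - u'|)
    (hv : v ∈ conjDom f) : |v| ≤ C := by
  obtain ⟨M, hM⟩ := hv
  by_contra! hlt
  have hM' : ∀ u, v * u - f u ≤ M := fun u => hM ⟨u, rfl⟩
  -- Along `u = sign v * t` the expression `v * u - f u` grows at least like `t * (|v| - C)`, up to
  -- the constant `f 0`.
  have hpos : 0 < |v| - C := by linarith
  have bound : ∀ t : ℝ, 0 ≤ t → t * (|v| - C) ≤ M + f 0 := by
    intro t ht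
    have h1 := hM' (SignType.sign v * t)
    have h2 := (le_abs_self _).trans (hf (SignType.sign v * t) 0)
    have h3 : v * (SignType.sign v * t) = |v| * t := by
      rw [← mul_assoc, self_mul_sign]
    have h4 : |(SignType.sign v : ℝ) * t - 0| ≤ t := by
      rw [sub_zero, abs_mul, abs_of_nonneg ht]
      have : |(SignType.sign v : ℝ)| ≤ 1 := by
        rcases lt_trichotomy v 0 with h | h | h <;> simp [h]
      nlinarith
    have hC : 0 ≤ C := by
      have := (abs_nonneg _).trans (hf 1 0)
      simpa using this
    have h5 := mul_le_mul_of_nonneg_left h4 hC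
    rw [h3] at h1
    nlinarith
  have h0 := bound ((|M + f 0| + 1) / (|v| - C)) (by positivity)
  rw [div_mul_cancel₀ _ hpos.ne'] at h0
  linarith [le_abs_self (M + f 0)]

/-- The variance of finitely many vectors is at most their mean square. -/
theorem mean_norm_sub_mean_sq_le {E : Type*} [NormedAddCommGroup E] [InnerProductSpace ℝ E]
    {n : ℕ} (v : Fin n → E) :
    (1 / (n : ℝ)) * ∑ j, ‖v j - (1 / (n : ℝ)) • ∑ i, v i‖ ^ 2
      ≤ (1 / (n : ℝ)) * ∑ j, ‖v j‖ ^ 2 := by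
  rcases Nat.eq_zero_or_pos n with rfl | hn
  · simp
  have hn' : (0 : ℝ) < n := by exact_mod_cast hn
  refine mul_le_mul_of_nonneg_left ?_ (by positivity)
  have e : ∑ j, ‖v j - (1 / (n : ℝ)) • ∑ i, v i‖ ^ 2
      = ∑ j, ‖v j‖ ^ 2 - (1 / (n : ℝ)) * ‖∑ i, v i‖ ^ 2 := by
    simp only [norm_sub_sq_real, Finset.sum_add_distrib, Finset.sum_sub_distrib, Finset.sum_const,
      Finset.card_univ, Fintype.card_fin, nsmul_eq_mul, ← Finset.mul_sum, ← sum_inner,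
      inner_smul_right, real_inner_self_eq_norm_sq, norm_smul, Real.norm_eq_abs, mul_pow, sq_abs]
    field_simp
    ring
  rw [e]
  have : 0 ≤ (1 / (n : ℝ)) * ‖∑ i, v i‖ ^ 2 := by positivity
  linarith

/-! ### Class membership and proximal map for a quadratic regularizer. -/

/-- Membership in the class for an unconstrained problem with quadratic regularizer whose
stochastic gradients are exact and bounded. -/
theorem CFCCO.inClass_of_exact_gradient {n d : ℕ} {p : CFCCO n d} {Cf Cg σ0 σ1 δ μ a : ℝ}
    (hX : p.X = Set.univ) (hr : p.r = fun x => μ / 2 * ‖x‖ ^ 2)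
    (hn : 0 < n) (hCf : 0 ≤ Cf) (haCg : a ≤ Cg) (haδ : Cf * a ≤ δ)
    (prob : ∀ i, IsProbabilityMeasure (p.P i)) (g_int : ∀ i x, Integrable (p.g i x) (p.P i))
    (D : Fin n → EuclideanSpace ℝ (Fin d) → EuclideanSpace ℝ (Fin d))
    (hD : ∀ i x, ‖D i x‖ ≤ a)
    (hg : ∀ i z x, HasGradientAt (fun x' => p.g i x' z) (D i x) x)
    (hm : ∀ i x, HasGradientAt (p.mean i) (D i x) x)
    (mean_convex : ∀ i, ConvexOn ℝ Set.univ (p.mean i))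
    (f_convex : ∀ i, ConvexOn ℝ Set.univ (p.f i))
    (f_lip : ∀ i u u', |p.f i u - p.f i u'| ≤ Cf * |u - u'|)
    (f_mono : ∀ i, (∃ (a : EuclideanSpace ℝ (Fin d) →L[ℝ] ℝ) (b : ℝ),
      ∀ x, p.mean i x = a x + b) ∨ Monotone (p.f i))
    (var_zero : ∀ i x, ∫⁻ z, ENNReal.ofReal ((p.mean i x - p.g i x z) ^ 2) ∂(p.P i)
      ≤ ENNReal.ofReal (σ0 ^ 2)) :
    p.InClass Cf Cg σ0 σ1 δ μ where
  X_closed := by rw [hX]; exact isClosed_univ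
  X_convex := by rw [hX]; exact convex_univ
  X_zero := by rw [hX]; trivial
  r_lsc := by
    rw [hr]
    exact (by fun_prop : Continuous fun x : EuclideanSpace ℝ (Fin d) =>
      μ / 2 * ‖x‖ ^ 2).lowerSemicontinuous.lowerSemicontinuousOn _
  r_convex := by
    rw [hr, hX, strongConvexOn_iff_convex]
    simpa using convexOn_const (0 : ℝ) (convex_univ (𝕜 := ℝ) (E := EuclideanSpace ℝ (Fin d)))
  prob := prob
  g_integrable := g_int
  g_diff := fun i z x => (hg i z x).differentiableAt
  mean_diff := fun i x => (hm i x).differentiableAt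
  mean_convex := mean_convex
  mean_lip := by
    intro i x x'
    have := Convex.norm_image_sub_le_of_norm_hasFDerivWithin_le (f := p.mean i) (C := a)
      (s := Set.univ) (x := x') (y := x)
      (fun y _ => ((hm i y).hasFDerivAt).hasFDerivWithinAt)
      (fun y _ => by simpa using hD i y) convex_univ trivial trivial
    rw [Real.norm_eq_abs] at this
    exact this.trans (mul_le_mul_of_nonneg_right haCg (norm_nonneg _))
  f_convex := f_convex
  f_lip := f_lip
  f_mono := f_mono
  var_zero := var_zero
  var_one := by
    intro i x
    simp [fun z => (hg i z x).gradient, (hm i x).gradient]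
  var_block := by
    intro x y hy
    have hn' : (0 : ℝ) < n := by exact_mod_cast hn
    -- Dual variables are bounded by the Lipschitz constant of the outer function, so each block
    -- gradient has norm at most `Cf * a ≤ δ`; the variance is below the mean square.
    have hb : ∀ j, ‖y j • D j x‖ ^ 2 ≤ δ ^ 2 := by
      intro j
      have h1 := abs_le_of_mem_conjDom (f_lip j) (hy j)
      have h2 : ‖y j • D j x‖ ≤ δ := by
        rw [norm_smul, Real.norm_eq_abs]
        exact (mul_le_mul h1 (hD j x) (norm_nonneg _) hCf).trans haδ
      exact pow_le_pow_left₀ (norm_nonneg _) h2 2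
    simp only [fun j => (hm j x).gradient]
    refine (mean_norm_sub_mean_sq_le fun j => y j • D j x).trans ?_
    have h3 : ∑ j, ‖y j • D j x‖ ^ 2 ≤ n * δ ^ 2 := by
      simpa using Finset.sum_le_sum fun j (_ : j ∈ Finset.univ) => hb j
    calc (1 / (n : ℝ)) * ∑ j, ‖y j • D j x‖ ^ 2 ≤ (1 / (n : ℝ)) * (n * δ ^ 2) := by gcongr
      _ = δ ^ 2 := by field_simp

/-- The proximal map of an unconstrained problem with quadratic regularizer. -/
theorem CFCCO.IsQP.smul_eq {n d : ℕ} {p : CFCCO n d} {μ η : ℝ}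
    {x₀ G x : EuclideanSpace ℝ (Fin d)} (hX : p.X = Set.univ)
    (hr : p.r = fun x => μ / 2 * ‖x‖ ^ 2) (hμ : 0 ≤ μ) (hη : 0 < η) (h : p.IsQP η x₀ G x) :
    x = (μ + η)⁻¹ • (η • x₀ - G) := by
  have hs : 0 < μ + η := by linarith
  set y := (μ + η)⁻¹ • (η • x₀ - G) with hy
  have hG : G = η • x₀ - (μ + η) • y := by
    rw [hy, smul_smul, mul_inv_cancel₀ hs.ne', one_smul]; abel
  -- Completing the square: the objective is a constant plus a multiple of the squared distance to
  -- `y`.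
  have key : ∀ w, inner ℝ w G + μ / 2 * ‖w‖ ^ 2 + η / 2 * ‖w - x₀‖ ^ 2
      = (η / 2 * ‖x₀‖ ^ 2 - (μ + η) / 2 * ‖y‖ ^ 2) + (μ + η) / 2 * ‖w - y‖ ^ 2 := by
    intro w
    rw [hG]
    simp only [norm_sub_sq_real, inner_sub_right, inner_smul_right]
    ring
  have h1 := h.2 (show y ∈ p.X by rw [hX]; trivial)
  simp only [Set.mem_ofPred_eq, hr, key, sub_self, norm_zero] at h1
  have h2 : ‖x - y‖ ^ 2 ≤ 0 := by
    by_contra! hlt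
    have := mul_pos (half_pos hs) hlt
    linarith
  have h3 : ‖x - y‖ = 0 := by nlinarith [norm_nonneg (x - y)]
  exact sub_eq_zero.1 (norm_eq_zero.1 h3)

theorem CFCCO.IsQP.mem {n d : ℕ} {p : CFCCO n d} {μ η : ℝ}
    {x₀ G x : EuclideanSpace ℝ (Fin d)} (hX : p.X = Set.univ)
    (hr : p.r = fun x => μ / 2 * ‖x‖ ^ 2) (hμ : 0 ≤ μ) (hη : 0 < η) (h : p.IsQP η x₀ G x)
    {V : Submodule ℝ (EuclideanSpace ℝ (Fin d))} (hx₀ : x₀ ∈ V) (hG : G ∈ V) : x ∈ V := by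
  rw [h.smul_eq hX hr hμ hη]
  exact V.smul_mem _ (V.sub_mem (V.smul_mem _ hx₀) hG)

/-! ### The separable problem with rarely observed inner values. -/

/-- The law of a coin that shows `true` with probability `q`. -/
noncomputable def coinLaw (q : ℝ) : Measure Bool :=
  ENNReal.ofReal q • Measure.dirac true + ENNReal.ofReal (1 - q) • Measure.dirac false

theorem isProbabilityMeasure_coinLaw {q : ℝ} (h0 : 0 ≤ q) (h1 : q ≤ 1) :
    IsProbabilityMeasure (coinLaw q) := by
  constructor
  simp only [coinLaw, Measure.coe_add, Measure.coe_smul, Pi.add_apply, Pi.smul_apply,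
    measure_univ, smul_eq_mul, mul_one]
  rw [← ENNReal.ofReal_add h0 (by linarith)]
  simp

theorem coinLaw_true (q : ℝ) : coinLaw q {true} = ENNReal.ofReal q := by
  simp [coinLaw]

theorem lintegral_coinLaw (q : ℝ) (φ : Bool → ENNReal) :
    ∫⁻ z, φ z ∂(coinLaw q) = ENNReal.ofReal q * φ true + ENNReal.ofReal (1 - q) * φ false := by
  simp [coinLaw]

theorem integrable_coinLaw (q : ℝ) (φ : Bool → ℝ) : Integrable φ (coinLaw q) := by
  have : IsFiniteMeasure (coinLaw q) := by
    constructor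
    simp [coinLaw]
  exact Integrable.of_finite

theorem integral_coinLaw {q : ℝ} (h0 : 0 ≤ q) (h1 : q ≤ 1) (φ : Bool → ℝ) :
    ∫ z, φ z ∂(coinLaw q) = q * φ true + (1 - q) * φ false := by
  rw [coinLaw, integral_add_measure, integral_smul_measure, integral_smul_measure,
    integral_dirac, integral_dirac, ENNReal.toReal_ofReal h0, ENNReal.toReal_ofReal (by linarith),
    smul_eq_mul, smul_eq_mul]
  · exact Integrable.smul_measure (integrable_dirac (by simp)) (by simp)
  · exact Integrable.smul_measure (integrable_dirac (by simp)) (by simp)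

/-- The separable problem whose `i`-th inner value `a x_i + m` is observed as `a x_i`, except with
probability `q`. -/
noncomputable def sparseProblem (n : ℕ) (f : ℝ → ℝ) (a m q μ : ℝ) : CFCCO n n where
  X := Set.univ
  r := fun x => μ / 2 * ‖x‖ ^ 2
  f := fun _ => f
  Z := Bool
  mZ := inferInstance
  P := fun _ => coinLaw q
  g := fun i x z => a * x i + if z then m / q else 0

section sparse

variable {n : ℕ} {f : ℝ → ℝ} {a m q μ : ℝ}

theorem sparseProblem_mean (h0 : 0 < q) (h1 : q ≤ 1) (i : Fin n)
    (x : EuclideanSpace ℝ (Fin n)) : (sparseProblem n f a m q μ).mean i x = a * x i + m := by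
  have := integral_coinLaw h0.le h1 (fun z => a * x i + if z then m / q else 0)
  refine Eq.trans this ?_
  simp only [↓reduceIte, Bool.false_eq_true]
  field_simp
  ring

theorem hasGradientAt_coord (a b : ℝ) (i : Fin n) (x : EuclideanSpace ℝ (Fin n)) :
    HasGradientAt (fun x : EuclideanSpace ℝ (Fin n) => a * x i + b)
      (a • EuclideanSpace.single i (1 : ℝ)) x := by
  refine hasGradientAt_of_quadratic_bound 0 fun y => ?_
  simp [inner_smul_left, EuclideanSpace.inner_single_left]
  ring

theorem sparseProblem_inClass {Cf Cg σ0 σ1 δ : ℝ} (hn : 0 < n) (hCf : 0 ≤ Cf) (ha : 0 ≤ a)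
    (haCg : a ≤ Cg) (haδ : Cf * a ≤ δ) (h0 : 0 < q) (h1 : q ≤ 1) (hm : m ^ 2 ≤ q * σ0 ^ 2)
    (f_convex : ConvexOn ℝ Set.univ f) (f_lip : ∀ u u', |f u - f u'| ≤ Cf * |u - u'|) :
    (sparseProblem n f a m q μ).InClass Cf Cg σ0 σ1 δ μ := by
  have hmean : ∀ i, (sparseProblem n f a m q μ).mean i = fun x => a * x i + m :=
    fun i => funext fun x => sparseProblem_mean h0 h1 i x
  refine CFCCO.inClass_of_exact_gradient (a := a) rfl rfl hn hCf haCg haδ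
    (fun _ => isProbabilityMeasure_coinLaw h0.le h1) (fun i x => integrable_coinLaw q _)
    (fun i _ => a • EuclideanSpace.single i (1 : ℝ)) ?_ ?_ ?_ ?_ (fun _ => f_convex)
    (fun _ => f_lip) ?_ ?_
  · intro i x
    simp [norm_smul, abs_of_nonneg ha]
  · intro i z x
    exact hasGradientAt_coord a _ i x
  · intro i x
    rw [hmean]
    exact hasGradientAt_coord a m i x
  · intro i
    rw [hmean]
    refine convexOn_univ_of_subgradient
      (fun _ => a • (EuclideanSpace.proj (𝕜 := ℝ) i : EuclideanSpace ℝ (Fin n) →L[ℝ] ℝ).toLinearMap)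
      fun x y => le_of_eq ?_
    simp
    ring
  · intro i
    -- The inner functions are affine, so the outer function need not be monotone; the pseudo-Huber
    -- function is not.
    refine Or.inl ⟨a • EuclideanSpace.proj (𝕜 := ℝ) i, m, fun x => ?_⟩
    rw [hmean]
    simp
  · intro i x
    rw [hmean]
    refine (lintegral_coinLaw q fun z => ENNReal.ofReal
      ((a * x i + m - (a * x i + if z then m / q else 0)) ^ 2)).trans_le ?_
    rw [← ENNReal.ofReal_mul h0.le, ← ENNReal.ofReal_mul (by linarith),
      ← ENNReal.ofReal_add (by positivity) (mul_nonneg (by linarith) (sq_nonneg _))]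
    refine ENNReal.ofReal_le_ofReal ?_
    simp only [↓reduceIte, Bool.false_eq_true]
    -- The variance is `(1 - q) * m ^ 2 / q`: the hypothesis `hm` is the price of hiding `m`.
    have e : q * (a * x i + m - (a * x i + m / q)) ^ 2
        + (1 - q) * (a * x i + m - (a * x i + 0)) ^ 2 = (1 - q) * (m ^ 2 / q) := by
      field_simp
      ring
    rw [e]
    have h2 : m ^ 2 / q ≤ σ0 ^ 2 := by
      rw [div_le_iff₀ h0]; linarith
    have h3 : 0 ≤ m ^ 2 / q := by positivity
    nlinarith

/-- Since `f` has minimum `0` at the origin, the conjugate is nonnegative and is `0` at `0`.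
Comparing `v` with the candidate `0` leaves a nonpositive Bregman divergence, and strict convexity,
tested at the midpoint `v / 2`, then forces `v = 0`. -/
theorem isMP_zero {ψ : DistGen} {τ v : ℝ} (hτ : 0 < τ) (hf : ∀ u, 0 ≤ f u) (hf0 : f 0 = 0)
    (h : IsMP f ψ τ 0 0 v) : v = 0 := by
  obtain ⟨s, ⟨h0, hs⟩, ⟨hv, hvψ⟩, hmax⟩ := h
  have hc0 : (0 : ℝ) ∈ conjDom f := ⟨0, by rintro _ ⟨u, rfl⟩; simpa using hf u⟩
  have hstar0 : fenchelConj f 0 ≤ 0 := ciSup_le fun u => by simpa using hf u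
  have hstar : 0 ≤ fenchelConj f v := by
    have := le_ciSup hv 0
    simpa [fenchelConj, hf0] using this
  have h1 := hmax ⟨hc0, h0⟩
  simp only [Set.mem_ofPred_eq, DistGen.bregman, mul_zero, sub_zero, sub_self] at h1
  have h2 : ψ.fn v - ψ.fn 0 - s * v ≤ 0 := by
    by_contra! hlt
    have := mul_pos hτ hlt
    linarith
  by_contra hne
  have h3 := ψ.strict.2 hvψ h0 hne (show (0 : ℝ) < 1 / 2 by norm_num)
    (show (0 : ℝ) < 1 / 2 by norm_num) (by norm_num)
  have h4 := hs _ (ψ.strict.1 hvψ h0 (show (0 : ℝ) ≤ 1 / 2 by norm_num)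
    (show (0 : ℝ) ≤ 1 / 2 by norm_num) (by norm_num))
  simp only [smul_eq_mul, mul_zero, add_zero, sub_zero] at h3 h4
  linarith

/-- A block that was never sampled together with the rare value stays at zero. -/
theorem sparseProblem_coord_eq_zero {τ η : ℝ} {ψ : Fin n → DistGen} (hμ : 0 ≤ μ) (hτ : 0 < τ)
    (hη : 0 < η) (hf : ∀ u, 0 ≤ f u) (hf0 : f 0 = 0) (B : ℕ → Finset (Fin n))
    (z z' : ℕ → Fin n → Bool) (i : Fin n) (T : ℕ)
    (hB : ∀ t < T, i ∈ B t → z t i = false) :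
    ∀ x ∈ (Spaces.iter (sparseProblem n f a m q μ) τ η ψ B z z' T).primal, x i = 0 := by
  set V : Submodule ℝ (EuclideanSpace ℝ (Fin n)) :=
    (EuclideanSpace.proj (𝕜 := ℝ) i : EuclideanSpace ℝ (Fin n) →L[ℝ] ℝ).toLinearMap.ker with hV
  have memV : ∀ x, x ∈ V ↔ x i = 0 := fun x => by simp [hV]
  -- The four spaces must be controlled together: each of them staying trivial in direction `i`
  -- relies on the previous one in the cycle.
  suffices H : ∀ t ≤ T, (Spaces.iter (sparseProblem n f a m q μ) τ η ψ B z z' t).inn i = ⊥ ∧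
      (Spaces.iter (sparseProblem n f a m q μ) τ η ψ B z z' t).dual i = ⊥ ∧
      (Spaces.iter (sparseProblem n f a m q μ) τ η ψ B z z' t).grad ≤ V ∧
      (Spaces.iter (sparseProblem n f a m q μ) τ η ψ B z z' t).primal ≤ V by
    intro x hx
    exact (memV x).1 ((H T le_rfl).2.2.2 hx)
  intro t
  induction t with
  | zero => intro _; simp [Spaces.iter, Spaces.init]
  | succ t ih =>
    intro ht
    obtain ⟨h1, h2, h3, h4⟩ := ih (by omega)
    set s := Spaces.iter (sparseProblem n f a m q μ) τ η ψ B z z' t with hs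
    have inn' : Spaces.nextInn (sparseProblem n f a m q μ) (B t) (z t) s i = ⊥ := by
      unfold Spaces.nextInn
      split_ifs with hi
      · rw [h1, bot_sup_eq, Submodule.span_eq_bot]
        rintro u ⟨x, hx, rfl⟩
        have hx0 := (memV x).1 (h4 hx)
        have hz := hB t (by omega) hi
        change a * x i + (if z t i = true then m / q else 0) = 0
        rw [hx0, hz]
        simp
      · exact h1
    have dual' : Spaces.nextDual (sparseProblem n f a m q μ) τ ψ (B t)
        (Spaces.nextInn (sparseProblem n f a m q μ) (B t) (z t) s) s i = ⊥ := by
      unfold Spaces.nextDual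
      split_ifs with hi
      · rw [h2, inn', bot_sup_eq, Submodule.span_eq_bot]
        rintro v ⟨y, hy, γ, hγ, hv⟩
        rw [Submodule.mem_bot] at hy hγ
        subst hy hγ
        exact isMP_zero hτ hf hf0 hv
      · exact h2
    have grad' : Spaces.nextGrad (sparseProblem n f a m q μ) (B t) (z' t)
        (Spaces.nextDual (sparseProblem n f a m q μ) τ ψ (B t)
          (Spaces.nextInn (sparseProblem n f a m q μ) (B t) (z t) s) s) s ≤ V := by
      refine sup_le h3 (Submodule.span_le.2 ?_)
      rintro G ⟨x, hx, y, hy, rfl⟩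
      refine V.smul_mem _ (V.sum_mem fun j _ => ?_)
      have hgrad : gradient (fun x' => (sparseProblem n f a m q μ).g j x' (z' t j)) x
          = a • EuclideanSpace.single j (1 : ℝ) :=
        (hasGradientAt_coord a _ j x).gradient
      rw [hgrad, memV]
      -- Only block `i` contributes to coordinate `i`, and its dual slice is still zero; the second
      -- sample plays no role.
      by_cases hij : j = i
      · subst hij
        have := hy j
        rw [dual', Submodule.mem_bot] at this
        simp [this]
      · simp [Ne.symm hij]
    refine ⟨inn', dual', grad', sup_le h4 (Submodule.span_le.2 ?_)⟩
    rintro x ⟨x₀, hx₀, G, hG, hx⟩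
    exact hx.mem rfl rfl hμ hη (h4 hx₀) (grad' hG)

end sparse

/-! ### Counting rare observations; blockwise optimality. -/

section sparse

variable {n : ℕ} {f : ℝ → ℝ} {a m q μ : ℝ}

/-- This is where independence of the batch from the samples enters. -/
theorem measureReal_sampled_true {S : ℕ} {Ω : Type u} [MeasurableSpace Ω] {Pr : Measure Ω}
    (s : Sampling (sparseProblem n f a m q μ) S Pr) (h0 : 0 ≤ q) (t : ℕ) (i : Fin n) :
    Pr.real {ω | i ∈ s.batch t ω ∧ s.ζ t i ω = true} = Pr.real {ω | i ∈ s.batch t ω} * q := by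
  have hind := (s.batch_indep t i).measure_inter_preimage_eq_mul {B | i ∈ B}
    ({true} ×ˢ Set.univ : Set (Bool × Bool)) (Set.toFinite _).measurableSet
    ((measurableSet_singleton (true : Bool)).prod MeasurableSet.univ)
  have hlaw : Pr (s.ζ t i ⁻¹' ({true} : Set Bool)) = ENNReal.ofReal q := by
    rw [← coinLaw_true, ← Measure.map_apply (s.ζ_meas t i) (measurableSet_singleton (true : Bool)),
      s.ζ_law t i]
    rfl
  have e1 : {ω | i ∈ s.batch t ω ∧ s.ζ t i ω = true} = s.batch t ⁻¹' {B | i ∈ B} ∩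
      (fun ω => (s.ζ t i ω, s.ζ' t i ω)) ⁻¹' ({true} ×ˢ Set.univ : Set (Bool × Bool)) := by
    ext ω
    constructor
    · exact fun h => ⟨h.1, h.2, trivial⟩
    · exact fun h => ⟨h.1, h.2.1⟩
  have e2 : (fun ω => (s.ζ t i ω, s.ζ' t i ω)) ⁻¹' ({true} ×ˢ Set.univ : Set (Bool × Bool))
      = s.ζ t i ⁻¹' ({true} : Set Bool) := by
    ext ω
    constructor
    · exact fun h => h.1
    · exact fun h => ⟨h, trivial⟩
  rw [measureReal_def, e1, hind, e2, hlaw, ENNReal.toReal_mul, ENNReal.toReal_ofReal h0]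
  rfl

/-- Double counting of the batch size, valid for any law of the batch. -/
theorem sum_measureReal_mem_batch {d S : ℕ} {p : CFCCO n d} {Ω : Type u} [MeasurableSpace Ω]
    {Pr : Measure Ω} [IsProbabilityMeasure Pr] (s : Sampling p S Pr) (t : ℕ) :
    ∑ i, Pr.real {ω | i ∈ s.batch t ω} = S := by
  have hmeas : ∀ i, MeasurableSet {ω | i ∈ s.batch t ω} := fun i =>
    s.batch_meas t (Set.toFinite {B : Finset (Fin n) | i ∈ B}).measurableSet
  calc ∑ i, Pr.real {ω | i ∈ s.batch t ω}
      = ∑ i, ∫ ω, Set.indicator {ω | i ∈ s.batch t ω} (fun _ => (1 : ℝ)) ω ∂Pr := by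
        refine Finset.sum_congr rfl fun i _ => ?_
        rw [integral_indicator_const _ (hmeas i)]
        simp
    _ = ∫ ω, ∑ i, Set.indicator {ω | i ∈ s.batch t ω} (fun _ => (1 : ℝ)) ω ∂Pr := by
        rw [integral_finsetSum]
        exact fun i _ => (integrable_const _).indicator (hmeas i)
    _ = ∫ _, (S : ℝ) ∂Pr := by
        congr 1
        ext ω
        refine Eq.trans ?_ (congrArg Nat.cast (s.batch_card t ω))
        simp [Set.indicator_apply]
    _ = S := by simp

open Classical in
/-- If every coordinate that vanishes contributes `ℓ / n` to the loss and `2 ε ≤ ℓ`, then half of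
the blocks have to be sampled together with the rare value. -/
theorem sparseProblem_needsCalls {S : ℕ} {D : Set (EuclideanSpace ℝ (Fin n))}
    {loss : EuclideanSpace ℝ (Fin n) → ℝ} {ε ℓ : ℝ} (hn : 0 < n) (hμ : 0 ≤ μ) (h0 : 0 < q)
    (hf : ∀ u, 0 ≤ f u) (hf0 : f 0 = 0) (hε : 0 < ε) (hℓ : 2 * ε ≤ ℓ)
    (hloss : ∀ x, ℓ / n * ∑ i, (if x i = 0 then 1 else 0) ≤ loss x) :
    NeedsCalls.{u} (sparseProblem n f a m q μ) S D loss ε (n / (2 * q)) := by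
  intro τ η ψ hτ hη Ω _ Pr _ s T xbar _ hmem hexp
  have hn' : (0 : ℝ) < n := by exact_mod_cast hn
  have hℓ0 : 0 < ℓ := by linarith
  set E : ℕ → Fin n → Set Ω := fun t i => {ω | i ∈ s.batch t ω ∧ s.ζ t i ω = true} with hE
  set U : Fin n → Set Ω := fun i => ⋃ t ∈ Finset.range T, E t i with hU
  have hEmeas : ∀ t i, MeasurableSet (E t i) := fun t i =>
    (s.batch_meas t (Set.toFinite {B : Finset (Fin n) | i ∈ B}).measurableSet).inter
      (s.ζ_meas t i (measurableSet_singleton (true : Bool)))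
  have hUmeas : ∀ i, MeasurableSet (U i) := fun i =>
    Finset.measurableSet_biUnion _ fun t _ => hEmeas t i
  -- `W` is an integrable minorant of the loss: each block outside its event `U i` still has
  -- coordinate zero. It avoids any measurability assumption on `loss` or on the random subspaces.
  set W : Ω → ℝ := fun ω => ℓ / n * ∑ i, (1 - (U i).indicator (fun _ => (1 : ℝ)) ω) with hW
  have hind : ∀ i ω, (U i).indicator (fun _ => (1 : ℝ)) ω ≤ 1 := fun i ω => by
    rw [Set.indicator_apply]; split_ifs <;> norm_num
  have hW0 : ∀ ω, 0 ≤ W ω := fun ω =>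
    mul_nonneg (by positivity) (Finset.sum_nonneg fun i _ => by linarith [hind i ω])
  have hWint : Integrable W Pr := by
    refine (integrable_finsetSum _ fun i _ => ?_).const_mul _
    exact (integrable_const _).sub ((integrable_const _).indicator (hUmeas i))
  have hWloss : ∀ᵐ ω ∂Pr, W ω ≤ loss (xbar ω) := by
    filter_upwards [hmem] with ω hω
    refine le_trans ?_ (hloss (xbar ω))
    refine mul_le_mul_of_nonneg_left (Finset.sum_le_sum fun i _ => ?_) (by positivity)
    by_cases hi : ω ∈ U i
    · rw [Set.indicator_of_mem hi, sub_self]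
      split_ifs <;> norm_num
    · have hx : xbar ω i = 0 := by
        refine sparseProblem_coord_eq_zero hμ hτ hη hf hf0 _ _ _ i T ?_ _ hω.1
        intro t ht hit
        refine Bool.eq_false_iff.2 fun hz => hi
          (Set.mem_biUnion (Finset.mem_coe.2 (Finset.mem_range.2 ht)) ⟨hit, hz⟩)
      rw [Set.indicator_of_notMem hi, if_pos hx, sub_zero]
  have hWle : ∫ ω, W ω ∂Pr ≤ ε := by
    rw [← ENNReal.ofReal_le_ofReal_iff hε.le,
      ofReal_integral_eq_lintegral_ofReal hWint (Filter.Eventually.of_forall hW0)]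
    refine le_trans (lintegral_mono_ae ?_) hexp
    filter_upwards [hWloss] with ω hω using ENNReal.ofReal_le_ofReal hω
  have hWeq : ∫ ω, W ω ∂Pr = ℓ / n * (n - ∑ i, Pr.real (U i)) := by
    rw [hW, integral_const_mul, integral_finsetSum]
    · congr 1
      have : ∀ i, ∫ ω, (1 - (U i).indicator (fun _ => (1 : ℝ)) ω) ∂Pr = 1 - Pr.real (U i) := by
        intro i
        rw [integral_sub (integrable_const _) ((integrable_const _).indicator (hUmeas i)),
          integral_indicator_const _ (hUmeas i)]
        simp
      simp [this]
    · exact fun i _ => (integrable_const _).sub ((integrable_const _).indicator (hUmeas i))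
  -- Union bound over iterations; each of them yields `S * q` rare hits in expectation.
  have hUle : ∑ i, Pr.real (U i) ≤ T * (S * q) := by
    calc ∑ i, Pr.real (U i) ≤ ∑ i, ∑ t ∈ Finset.range T, Pr.real (E t i) :=
          Finset.sum_le_sum fun i _ => measureReal_biUnion_finset_le _ _
      _ = ∑ t ∈ Finset.range T, (∑ i, Pr.real {ω | i ∈ s.batch t ω}) * q := by
          rw [Finset.sum_comm]
          refine Finset.sum_congr rfl fun t _ => ?_
          rw [Finset.sum_mul]
          exact Finset.sum_congr rfl fun i _ => measureReal_sampled_true s h0.le t i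
      _ = T * (S * q) := by simp [sum_measureReal_mem_batch]
  -- As `ε ≤ ℓ / 2`, the expected proportion of untouched blocks is at most one half.
  have h1 : ℓ / n * (n - T * (S * q)) ≤ ℓ / 2 := by
    have h2 : ℓ / n * (n - T * (S * q)) ≤ ℓ / n * (n - ∑ i, Pr.real (U i)) := by gcongr
    linarith
  rw [div_le_iff₀ (by positivity)]
  have h3 : ℓ / n * (n - T * (S * q)) = ℓ * ((n - T * (S * q)) / n) := by ring
  rw [h3, div_eq_mul_one_div ℓ 2, mul_le_mul_iff_right₀ hℓ0, div_le_iff₀ hn'] at h1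
  linarith

/-- Splitting the regularizer over the blocks against the average `1 / n` gives each block the
curvature `n * μ`, the source of all conditions on `n * μ`. -/
theorem sparseProblem_F (hn : 0 < n) (h0 : 0 < q) (h1 : q ≤ 1) (x : EuclideanSpace ℝ (Fin n)) :
    (sparseProblem n f a m q μ).F x
      = (1 / (n : ℝ)) * ∑ i, (f (a * x i + m) + n * μ / 2 * x i ^ 2) := by
  have hn' : (n : ℝ) ≠ 0 := by exact_mod_cast hn.ne'
  rw [CFCCO.F]
  simp only [sparseProblem_mean h0 h1]
  rw [Finset.sum_add_distrib, ← Finset.mul_sum, mul_add]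
  congr 1
  change μ / 2 * ‖x‖ ^ 2 = _
  rw [EuclideanSpace.norm_sq_eq]
  simp only [Real.norm_eq_abs, sq_abs]
  field_simp

/-- The optimality condition of one block. -/
theorem sparseProblem_scalar_le {w θ v ν : ℝ} (hν : 0 ≤ ν) (hθ : ∀ u, f w + θ * (u - w) ≤ f u)
    (hw : w = a * v + m) (hs : a * θ + ν * v = 0) (y : ℝ) :
    f (a * v + m) + ν / 2 * v ^ 2 ≤ f (a * y + m) + ν / 2 * y ^ 2 := by
  have h1 := hθ (a * y + m)
  rw [← hw]
  have h2 : θ * (a * y + m - w) = - (ν * v) * (y - v) := by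
    rw [hw]; linear_combination (y - v) * hs
  have h3 : 0 ≤ ν / 2 * (y - v) ^ 2 := by positivity
  nlinarith

theorem sparseProblem_isMinimizer {w θ v : ℝ} (hn : 0 < n) (h0 : 0 < q) (h1 : q ≤ 1)
    (hμ : 0 ≤ μ) (hθ : ∀ u, f w + θ * (u - w) ≤ f u) (hw : w = a * v + m)
    (hs : a * θ + n * μ * v = 0) :
    (sparseProblem n f a m q μ).IsMinimizer (WithLp.toLp 2 fun _ => v) := by
  refine ⟨trivial, fun y _ => ?_⟩
  simp only [Set.mem_ofPred_eq, sparseProblem_F hn h0 h1]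
  refine mul_le_mul_of_nonneg_left (Finset.sum_le_sum fun i _ => ?_) (by positivity)
  exact sparseProblem_scalar_le (by positivity) hθ hw hs (y i)

end sparse

/-! ### Projections and smoothed support functions. -/

section smoothing

variable {E : Type*} [NormedAddCommGroup E] [InnerProductSpace ℝ E]

open Classical in
/-- The projection onto `K`, characterized by its variational inequality. -/
noncomputable def projOn (K : Set E) (x : E) : E :=
  Classical.epsilon fun v => v ∈ K ∧ ∀ w ∈ K, inner ℝ (x - v) (w - v) ≤ 0

/-- The smoothed support function `x ↦ max_{q ∈ K} {⟨q, x - σ s⟩ - (σ/2) ‖q‖²}`. -/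
noncomputable def smoothedSupport (K : Set E) (s : E) (σ : ℝ) (x : E) : ℝ :=
  inner ℝ (projOn K (σ⁻¹ • x - s)) (x - σ • s) - σ / 2 * ‖projOn K (σ⁻¹ • x - s)‖ ^ 2

variable {K : Set E}

theorem projOn_spec (hne : K.Nonempty) (hK : IsComplete K) (hconv : Convex ℝ K) (x : E) :
    projOn K x ∈ K ∧ ∀ w ∈ K, inner ℝ (x - projOn K x) (w - projOn K x) ≤ 0 := by
  obtain ⟨v, hv, h⟩ := exists_norm_eq_iInf_of_complete_convex hne hK hconv x
  exact Classical.epsilon_spec (p := fun v => v ∈ K ∧ ∀ w ∈ K, inner ℝ (x - v) (w - v) ≤ 0)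
    ⟨v, hv, (norm_eq_iInf_iff_real_inner_le_zero hconv hv).1 h⟩

/-- Up to a constant, the maximand is `-(σ / 2)` times the squared distance from `q` to `σ⁻¹ • x -
s`. It is maximal at the projection, and the variational inequality supplies the quadratic surplus.
-/
theorem le_smoothedSupport (hne : K.Nonempty) (hK : IsComplete K) (hconv : Convex ℝ K)
    (s : E) {σ : ℝ} (hσ : 0 < σ) (x : E) {q : E} (hq : q ∈ K) :
    inner ℝ q (x - σ • s) - σ / 2 * ‖q‖ ^ 2 + σ / 2 * ‖q - projOn K (σ⁻¹ • x - s)‖ ^ 2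
      ≤ smoothedSupport K s σ x := by
  obtain ⟨-, h⟩ := projOn_spec hne hK hconv (σ⁻¹ • x - s)
  have h1 := mul_nonpos_of_nonneg_of_nonpos hσ.le (h q hq)
  unfold smoothedSupport
  set v := projOn K (σ⁻¹ • x - s)
  have e : x - σ • s = σ • (σ⁻¹ • x - s) := by
    rw [smul_sub, smul_inv_smul₀ hσ.ne']
  rw [e]
  set y := σ⁻¹ • x - s
  simp only [norm_sub_sq_real, inner_sub_left, inner_sub_right, inner_smul_right,
    real_inner_self_eq_norm_sq] at h1 ⊢
  rw [real_inner_comm y q, real_inner_comm y v, real_inner_comm q v] at *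
  linarith

theorem smoothedSupport_subgradient (hne : K.Nonempty) (hK : IsComplete K) (hconv : Convex ℝ K)
    (s : E) {σ : ℝ} (hσ : 0 < σ) (x y : E) :
    smoothedSupport K s σ x + inner ℝ (projOn K (σ⁻¹ • x - s)) (y - x)
      ≤ smoothedSupport K s σ y := by
  have h := le_smoothedSupport hne hK hconv s hσ y (projOn_spec hne hK hconv (σ⁻¹ • x - s)).1
  have h1 : 0 ≤ σ / 2 * ‖projOn K (σ⁻¹ • x - s) - projOn K (σ⁻¹ • y - s)‖ ^ 2 := by positivity
  conv_lhs => unfold smoothedSupport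
  simp only [inner_sub_right] at h ⊢
  linarith

/-- The surplus in `le_smoothedSupport`, applied at `x` to the maximizer for `y`, absorbs the cross
term after completing a square. With the subgradient inequality it yields differentiability. -/
theorem smoothedSupport_le (hne : K.Nonempty) (hK : IsComplete K) (hconv : Convex ℝ K)
    (s : E) {σ : ℝ} (hσ : 0 < σ) (x y : E) :
    smoothedSupport K s σ y ≤ smoothedSupport K s σ x
      + inner ℝ (projOn K (σ⁻¹ • x - s)) (y - x) + (2 * σ)⁻¹ * ‖y - x‖ ^ 2 := by
  have h := le_smoothedSupport hne hK hconv s hσ x (projOn_spec hne hK hconv (σ⁻¹ • y - s)).1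
  conv_lhs => unfold smoothedSupport
  set q := projOn K (σ⁻¹ • y - s)
  set v := projOn K (σ⁻¹ • x - s)
  have h1 : 0 ≤ (2 * σ)⁻¹ * ‖σ • (q - v) - (y - x)‖ ^ 2 := by positivity
  have h2 : (2 * σ)⁻¹ * ‖σ • (q - v) - (y - x)‖ ^ 2
      = σ / 2 * ‖q - v‖ ^ 2 - inner ℝ (q - v) (y - x) + (2 * σ)⁻¹ * ‖y - x‖ ^ 2 := by
    rw [norm_sub_sq_real, norm_smul, inner_smul_left, Real.norm_eq_abs, mul_pow, sq_abs]
    simp only [conj_trivial]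
    field_simp
  rw [h2] at h1
  simp only [inner_sub_right, inner_sub_left] at h h1 ⊢
  linarith

theorem hasGradientAt_smoothedSupport [CompleteSpace E] (hne : K.Nonempty) (hK : IsComplete K)
    (hconv : Convex ℝ K) (s : E) {σ : ℝ} (hσ : 0 < σ) (x : E) :
    HasGradientAt (smoothedSupport K s σ) (projOn K (σ⁻¹ • x - s)) x := by
  refine hasGradientAt_of_quadratic_bound (2 * σ)⁻¹ fun y => ?_
  have h1 := smoothedSupport_subgradient hne hK hconv s hσ x y
  have h2 := smoothedSupport_le hne hK hconv s hσ x y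
  rw [abs_of_nonneg (by linarith)]
  linarith

theorem convexOn_smoothedSupport (hne : K.Nonempty) (hK : IsComplete K) (hconv : Convex ℝ K)
    (s : E) {σ : ℝ} (hσ : 0 < σ) : ConvexOn ℝ Set.univ (smoothedSupport K s σ) :=
  convexOn_univ_of_subgradient (fun x => (innerₗ E (projOn K (σ⁻¹ • x - s))))
    fun x y => smoothedSupport_subgradient hne hK hconv s hσ x y

end smoothing

/-! ### The simplex and the one-coordinate-at-a-time property. -/

/-- The standard simplex in Euclidean space. -/
def euclideanSimplex (k : ℕ) : Set (EuclideanSpace ℝ (Fin k)) :=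
  {q | (∀ j, 0 ≤ q j) ∧ ∑ j, q j = 1}

theorem convex_euclideanSimplex (k : ℕ) : Convex ℝ (euclideanSimplex k) := by
  intro x hx y hy s t hs ht hst
  refine ⟨fun j => ?_, ?_⟩
  · have := hx.1 j
    have := hy.1 j
    simp only [PiLp.add_apply, PiLp.smul_apply, smul_eq_mul]
    positivity
  · simp [Finset.sum_add_distrib, ← Finset.mul_sum, hx.2, hy.2, hst]

theorem isComplete_euclideanSimplex (k : ℕ) : IsComplete (euclideanSimplex k) := by
  refine IsClosed.isComplete (IsClosed.inter ?_ ?_)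
  · have : {q : EuclideanSpace ℝ (Fin k) | ∀ j, 0 ≤ q j} = ⋂ j, {q | 0 ≤ q j} := by
      ext; simp
    change IsClosed {q : EuclideanSpace ℝ (Fin k) | ∀ j, 0 ≤ q j}
    rw [this]
    exact isClosed_iInter fun j => isClosed_le continuous_const (by fun_prop)
  · exact isClosed_eq (by fun_prop) continuous_const

theorem euclideanSimplex_apply_le_one {k : ℕ} {q : EuclideanSpace ℝ (Fin k)}
    (hq : q ∈ euclideanSimplex k) (j : Fin k) : q j ≤ 1 := by
  rw [← hq.2]
  exact Finset.single_le_sum (fun i _ => hq.1 i) (Finset.mem_univ j)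

theorem norm_le_one_of_mem_euclideanSimplex {k : ℕ} {q : EuclideanSpace ℝ (Fin k)}
    (hq : q ∈ euclideanSimplex k) : ‖q‖ ≤ 1 := by
  have h : ‖q‖ ^ 2 ≤ 1 := by
    rw [EuclideanSpace.norm_sq_eq, ← hq.2]
    refine Finset.sum_le_sum fun j _ => ?_
    rw [Real.norm_eq_abs, sq_abs]
    nlinarith [hq.1 j, euclideanSimplex_apply_le_one hq j]
  nlinarith [norm_nonneg q]

/-- The vector `(0, 1, …, k - 1)`. -/
def indexVec (k : ℕ) : EuclideanSpace ℝ (Fin k) := WithLp.toLp 2 fun j => (j : ℝ)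

/-- The vectors supported on the first `t` coordinates. -/
def headSpace (k t : ℕ) : Submodule ℝ (EuclideanSpace ℝ (Fin k)) where
  carrier := {x | ∀ j : Fin k, t ≤ j → x j = 0}
  add_mem' := fun hx hy j hj => by simp [hx j hj, hy j hj]
  zero_mem' := fun j _ => by simp
  smul_mem' := fun c x hx j hj => by simp [hx j hj]

theorem headSpace_mono (k : ℕ) {t t' : ℕ} (h : t ≤ t') : headSpace k t ≤ headSpace k t' :=
  fun _ hx j hj => hx j (h.trans hj)

theorem euclideanSimplex_nonempty {k : ℕ} (hk : 0 < k) : (euclideanSimplex k).Nonempty := by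
  classical
  refine ⟨EuclideanSpace.single (⟨0, hk⟩ : Fin k) (1 : ℝ), fun j => ?_, ?_⟩
  · rw [PiLp.single_apply]
    split_ifs <;> norm_num
  · simp [PiLp.single_apply]

theorem projOn_simplex_spec {k : ℕ} (hk : 0 < k) (x : EuclideanSpace ℝ (Fin k)) :
    projOn (euclideanSimplex k) x ∈ euclideanSimplex k ∧
      ∀ w ∈ euclideanSimplex k, inner ℝ (x - projOn (euclideanSimplex k) x)
        (w - projOn (euclideanSimplex k) x) ≤ 0 :=
  projOn_spec (euclideanSimplex_nonempty hk) (isComplete_euclideanSimplex k)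
    (convex_euclideanSimplex k) x

/-- The gradients of the smoothed maximum reveal one coordinate at a time. -/
theorem projOn_mem_headSpace {k t : ℕ} (hk : 0 < k) {x : EuclideanSpace ℝ (Fin k)} (c : ℝ)
    (hx : x ∈ headSpace k t) :
    projOn (euclideanSimplex k) (c • x - indexVec k) ∈ headSpace k (t + 1) := by
  classical
  obtain ⟨hv, hvi⟩ := projOn_simplex_spec hk (c • x - indexVec k)
  set v := projOn (euclideanSimplex k) (c • x - indexVec k)
  intro j hj
  by_contra hne
  have hpos : 0 < v j := lt_of_le_of_ne (hv.1 j) (Ne.symm hne)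
  have htk : t < k := by omega
  set i : Fin k := ⟨t, htk⟩ with hi
  have hij : i ≠ j := by
    intro h
    rw [← h] at hj
    simp [hi] at hj
  -- Moving all mass from `j` to the earlier index `t` is feasible. It would improve the projection,
  -- because `x` vanishes at both indices and the shifts differ by at least `1 ≥ v i`.
  have hw : v + v j • (EuclideanSpace.single i (1 : ℝ) - EuclideanSpace.single j (1 : ℝ))
      ∈ euclideanSimplex k := by
    refine ⟨fun l => ?_, ?_⟩
    · have hl := hv.1 l
      simp only [PiLp.add_apply, PiLp.smul_apply, PiLp.sub_apply, PiLp.single_apply, smul_eq_mul]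
      by_cases hlj : l = j
      · subst hlj
        simp [Ne.symm hij]
      · rw [if_neg hlj]
        split_ifs <;> simp <;> linarith
    · have h2 := hv.2
      simp only [PiLp.add_apply, PiLp.smul_apply, PiLp.sub_apply, PiLp.single_apply, smul_eq_mul,
        Finset.sum_add_distrib, ← Finset.mul_sum, Finset.sum_sub_distrib, Finset.sum_ite_eq',
        Finset.mem_univ, if_true, sub_self, mul_zero, add_zero, h2]
  have h := hvi _ hw
  rw [add_sub_cancel_left, inner_smul_right, inner_sub_right,
    EuclideanSpace.inner_single_right, EuclideanSpace.inner_single_right] at h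
  have hxi : x i = 0 := hx i le_rfl
  have hxj : x j = 0 := hx j (by omega)
  simp only [PiLp.sub_apply, PiLp.smul_apply, hxi, hxj, smul_zero, zero_sub, one_mul,
    conj_trivial, indexVec] at h
  have h1 : (t : ℝ) + 1 ≤ (j : ℕ) := by exact_mod_cast hj
  have h2 := euclideanSimplex_apply_le_one hv i
  have h3 : 0 < v j * (-(t : ℝ) - v i - (-(j : ℝ) - v j)) := mul_pos hpos (by linarith)
  simp only [hi] at h h3
  linarith

/-! ### The chain problem. -/

/-- The problem with the same deterministic inner function `a h` in every block and with linear
outer functions. -/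
noncomputable def chainProblem (n k : ℕ) (Cf a μ σ : ℝ) : CFCCO n k where
  X := Set.univ
  r := fun x => μ / 2 * ‖x‖ ^ 2
  f := fun _ u => Cf * u
  Z := Unit
  mZ := inferInstance
  P := fun _ => Measure.dirac ()
  g := fun _ x _ => a * smoothedSupport (euclideanSimplex k) (indexVec k) σ x

section chain

variable {n k : ℕ} {Cf a μ σ : ℝ}

theorem chainProblem_mean (i : Fin n) : (chainProblem n k Cf a μ σ).mean i
    = fun x => a * smoothedSupport (euclideanSimplex k) (indexVec k) σ x :=
  funext fun x => integral_dirac (fun _ : Unit =>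
    a * smoothedSupport (euclideanSimplex k) (indexVec k) σ x) ()

theorem hasGradientAt_mul_smoothedSupport (hk : 0 < k) (hσ : 0 < σ)
    (x : EuclideanSpace ℝ (Fin k)) :
    HasGradientAt (fun x => a * smoothedSupport (euclideanSimplex k) (indexVec k) σ x)
      (a • projOn (euclideanSimplex k) (σ⁻¹ • x - indexVec k)) x := by
  have h := hasGradientAt_smoothedSupport (euclideanSimplex_nonempty hk)
    (isComplete_euclideanSimplex k) (convex_euclideanSimplex k) (indexVec k) hσ x
  rw [hasGradientAt_iff_hasFDerivAt] at h ⊢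
  simpa using h.const_mul a

theorem chainProblem_inClass {Cg σ0 σ1 δ : ℝ} (hn : 0 < n) (hk : 0 < k) (hσ : 0 < σ)
    (hCf : 0 ≤ Cf) (ha : 0 ≤ a) (haCg : a ≤ Cg) (haδ : Cf * a ≤ δ) :
    (chainProblem n k Cf a μ σ).InClass Cf Cg σ0 σ1 δ μ := by
  refine CFCCO.inClass_of_exact_gradient (a := a) rfl rfl hn hCf haCg haδ
    (fun _ => Measure.dirac.isProbabilityMeasure)
    (fun i x => integrable_const (μ := Measure.dirac ())
      (a * smoothedSupport (euclideanSimplex k) (indexVec k) σ x))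
    (fun _ x => a • projOn (euclideanSimplex k) (σ⁻¹ • x - indexVec k)) ?_ ?_ ?_ ?_ ?_ ?_ ?_ ?_
  · intro i x
    rw [norm_smul, Real.norm_eq_abs, abs_of_nonneg ha]
    exact mul_le_of_le_one_right ha (norm_le_one_of_mem_euclideanSimplex
      (projOn_simplex_spec hk _).1)
  · exact fun i z x => hasGradientAt_mul_smoothedSupport hk hσ x
  · intro i x
    rw [chainProblem_mean]
    exact hasGradientAt_mul_smoothedSupport hk hσ x
  · intro i
    rw [chainProblem_mean]
    exact (convexOn_smoothedSupport (euclideanSimplex_nonempty hk)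
      (isComplete_euclideanSimplex k) (convex_euclideanSimplex k) (indexVec k) hσ).smul ha
  · intro i
    exact convexOn_univ_of_subgradient (fun _ => Cf • LinearMap.id) fun x y =>
      le_of_eq (by simp [chainProblem]; ring)
  · intro i u u'
    change |Cf * u - Cf * u'| ≤ _
    rw [← mul_sub, abs_mul, abs_of_nonneg hCf]
  · exact fun i => Or.inr fun u v huv => mul_le_mul_of_nonneg_left huv hCf
  · intro i x
    rw [chainProblem_mean]
    refine (lintegral_dirac () (fun _ : Unit => ENNReal.ofReal
      ((a * smoothedSupport (euclideanSimplex k) (indexVec k) σ x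
        - a * smoothedSupport (euclideanSimplex k) (indexVec k) σ x) ^ 2))).trans_le ?_
    simp

theorem chainProblem_outerSmooth {Lf : ℝ} (hLf : 0 ≤ Lf) (i : Fin n) :
    OuterSmooth ((chainProblem n k Cf a μ σ).f i) Lf := by
  have hd : ∀ v, HasDerivAt (fun u : ℝ => Cf * u) Cf v := fun v => by
    simpa using (hasDerivAt_id v).const_mul Cf
  refine ⟨fun u => (hd u).differentiableAt, fun u v => ?_⟩
  change |Cf * u - Cf * v - deriv (fun u : ℝ => Cf * u) v * (u - v)| ≤ _
  rw [(hd v).deriv, ← mul_sub, sub_self, abs_zero]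
  positivity

/-- New gradients are evaluated at points of the old primal space, so the support grows by at most
one index per iteration, for every batch and all dual values. -/
theorem chainProblem_primal_le {τ η : ℝ} {ψ : Fin n → DistGen} (hk : 0 < k) (hσ : 0 < σ)
    (hμ : 0 ≤ μ) (hη : 0 < η) (B : ℕ → Finset (Fin n))
    (z z' : ℕ → Fin n → (chainProblem n k Cf a μ σ).Z) (t : ℕ) :
    (Spaces.iter (chainProblem n k Cf a μ σ) τ η ψ B z z' t).grad ≤ headSpace k t ∧
      (Spaces.iter (chainProblem n k Cf a μ σ) τ η ψ B z z' t).primal ≤ headSpace k t := by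
  induction t with
  | zero => simp [Spaces.iter, Spaces.init]
  | succ t ih =>
    obtain ⟨h1, h2⟩ := ih
    have hmono := headSpace_mono k t.le_succ
    have grad' : (Spaces.iter (chainProblem n k Cf a μ σ) τ η ψ B z z' (t + 1)).grad
        ≤ headSpace k (t + 1) := by
      refine sup_le (h1.trans hmono) (Submodule.span_le.2 ?_)
      rintro G ⟨x, hx, y, -, rfl⟩
      refine Submodule.smul_mem _ _ (Submodule.sum_mem _ fun j _ => Submodule.smul_mem _ _ ?_)
      have hgrad : gradient (fun x' => (chainProblem n k Cf a μ σ).g j x' (z' t j)) x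
          = a • projOn (euclideanSimplex k) (σ⁻¹ • x - indexVec k) :=
        (hasGradientAt_mul_smoothedSupport hk hσ x).gradient
      rw [hgrad]
      exact Submodule.smul_mem _ _ (projOn_mem_headSpace hk _ (h2 hx))
    refine ⟨grad', sup_le (h2.trans hmono) (Submodule.span_le.2 ?_)⟩
    rintro x ⟨x₀, hx₀, G, hG, hx⟩
    exact hx.mem rfl rfl hμ hη (hmono (h2 hx₀)) (grad' hG)

/-- The gradient of the smoothed maximum at the minimizer of the chain problem. -/
noncomputable def chainWeights (k : ℕ) : EuclideanSpace ℝ (Fin k) :=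
  WithLp.toLp 2 fun j => 1 / (k : ℝ) + (((k : ℝ) - 1) / 2 - j) / (1 + (k : ℝ) ^ 2)

/-- The deviation from the uniform weight `1 / k` is at most `(k / 2) / (1 + k ^ 2)`, below half of
it. -/
theorem le_chainWeights (hk : 0 < k) (j : Fin k) : 1 / (2 * (k : ℝ)) ≤ chainWeights k j := by
  have hk' : (1 : ℝ) ≤ k := by exact_mod_cast hk
  have hj : ((j : ℕ) : ℝ) ≤ k - 1 := by
    have : (j : ℕ) + 1 ≤ k := j.2
    have : ((j : ℕ) : ℝ) + 1 ≤ k := by exact_mod_cast this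
    linarith
  have h1 : -(((k : ℝ)) / 2) / (1 + (k : ℝ) ^ 2)
      ≤ (((k : ℝ) - 1) / 2 - j) / (1 + (k : ℝ) ^ 2) := by
    gcongr
    linarith
  have h2 : ((k : ℝ) / 2) / (1 + (k : ℝ) ^ 2) ≤ 1 / (2 * (k : ℝ)) := by
    rw [div_le_div_iff₀ (by positivity) (by positivity)]
    nlinarith
  have h3 : 1 / (k : ℝ) = 1 / (2 * (k : ℝ)) + 1 / (2 * (k : ℝ)) := by field_simp; norm_num
  change _ ≤ 1 / (k : ℝ) + (((k : ℝ) - 1) / 2 - j) / (1 + (k : ℝ) ^ 2)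
  rw [neg_div] at h1
  linarith

theorem chainWeights_mem (hk : 0 < k) : chainWeights k ∈ euclideanSimplex k := by
  have hk' : (0 : ℝ) < k := by exact_mod_cast hk
  refine ⟨fun j => le_trans (by positivity) (le_chainWeights hk j), ?_⟩
  have h1 : ∑ j : Fin k, ((j : ℕ) : ℝ) = k * (k - 1) / 2 := by
    rw [Fin.sum_univ_eq_sum_range (fun j => (j : ℝ)) k]
    clear hk hk'
    induction k with
    | zero => simp
    | succ k ih => rw [Finset.sum_range_succ, ih]; push_cast; ring
  simp only [chainWeights, Finset.sum_add_distrib, ← Finset.sum_div, Finset.sum_sub_distrib, h1,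
    Finset.sum_const, Finset.card_univ, Fintype.card_fin, nsmul_eq_mul]
  field_simp
  ring

/-- The weights make `(1 + k ^ 2) * w j + j` independent of `j`. On the simplex the maximand
therefore equals `σ * ⟨v, w⟩ - σ / 2 * ‖v‖ ^ 2` up to a constant, which is largest at `v = w`. -/
theorem smoothedSupport_chain_le (hk : 0 < k) (hσ : 0 < σ) :
    smoothedSupport (euclideanSimplex k) (indexVec k) σ (-(σ * k ^ 2) • chainWeights k)
      ≤ inner ℝ (chainWeights k) (-(σ * k ^ 2) • chainWeights k - σ • indexVec k)
        - σ / 2 * ‖chainWeights k‖ ^ 2 := by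
  unfold smoothedSupport
  have hq := (projOn_simplex_spec hk
    (σ⁻¹ • -(σ * (k : ℝ) ^ 2) • chainWeights k - indexVec k)).1
  set q := projOn (euclideanSimplex k) (σ⁻¹ • -(σ * (k : ℝ) ^ 2) • chainWeights k - indexVec k)
  set w := chainWeights k with hw
  have hwm : w ∈ euclideanSimplex k := chainWeights_mem hk
  have hk2 : (1 + (k : ℝ) ^ 2) ≠ 0 := by positivity
  have e1 : ∀ v ∈ euclideanSimplex k,
      inner ℝ v (-(σ * (k : ℝ) ^ 2) • w - σ • indexVec k)
        = σ * inner ℝ v w - σ * (1 + k ^ 2) * (1 / k + ((k - 1) / 2) / (1 + k ^ 2)) := by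
    intro v hv
    have hs : ∑ j, v j * (1 / k + ((k - 1) / 2) / (1 + (k : ℝ) ^ 2))
        = 1 / k + ((k - 1) / 2) / (1 + (k : ℝ) ^ 2) := by
      rw [← Finset.sum_mul, hv.2, one_mul]
    rw [PiLp.inner_apply, PiLp.inner_apply, ← hs, Finset.mul_sum, Finset.mul_sum,
      ← Finset.sum_sub_distrib]
    refine Finset.sum_congr rfl fun j _ => ?_
    have hwj : w j = 1 / k + (((k : ℝ) - 1) / 2 - j) / (1 + (k : ℝ) ^ 2) := rfl
    have hij : indexVec k j = (j : ℝ) := rfl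
    simp only [PiLp.sub_apply, PiLp.smul_apply, smul_eq_mul, RCLike.inner_apply, conj_trivial,
      hwj, hij]
    field_simp
    ring
  rw [e1 q hq, e1 w hwm, real_inner_self_eq_norm_sq]
  have h2 : 0 ≤ σ / 2 * ‖q - w‖ ^ 2 := by positivity
  rw [norm_sub_sq_real] at h2
  linarith

theorem chainProblem_F (hn : 0 < n) (x : EuclideanSpace ℝ (Fin k)) :
    (chainProblem n k Cf a μ σ).F x = Cf * a *
      smoothedSupport (euclideanSimplex k) (indexVec k) σ x + μ / 2 * ‖x‖ ^ 2 := by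
  have hn' : (n : ℝ) ≠ 0 := by exact_mod_cast hn.ne'
  simp only [CFCCO.F, chainProblem_mean]
  simp only [chainProblem, Finset.sum_const, Finset.card_univ, Fintype.card_fin, nsmul_eq_mul]
  field_simp

/-- Fixing the weights `w` in the maximum bounds the objective below by a quadratic that is minimal
at `-(σ * k ^ 2) • w`, by `hA`; at that point the bound is attained. -/
theorem chainProblem_isMinimizer (hn : 0 < n) (hk : 0 < k) (hσ : 0 < σ) (hCf : 0 ≤ Cf)
    (ha : 0 ≤ a) (hμ : 0 ≤ μ) (hA : Cf * a = μ * (σ * k ^ 2)) :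
    (chainProblem n k Cf a μ σ).IsMinimizer (-(σ * k ^ 2) • chainWeights k) := by
  refine ⟨trivial, fun y _ => ?_⟩
  simp only [Set.mem_ofPred_eq, chainProblem_F hn]
  have h1 := smoothedSupport_chain_le hk hσ
  have h2 := le_smoothedSupport (euclideanSimplex_nonempty hk)
      (isComplete_euclideanSimplex k) (convex_euclideanSimplex k) (indexVec k) hσ y
      (chainWeights_mem hk)
  set w := chainWeights k
  have h3 : 0 ≤ σ / 2 * ‖w - projOn (euclideanSimplex k) (σ⁻¹ • y - indexVec k)‖ ^ 2 := by
    positivity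
  have h4 : smoothedSupport (euclideanSimplex k) (indexVec k) σ (-(σ * k ^ 2) • w)
      ≤ smoothedSupport (euclideanSimplex k) (indexVec k) σ y
        - inner ℝ w y - σ * k ^ 2 * ‖w‖ ^ 2 := by
    simp only [inner_sub_right, inner_smul_right, real_inner_self_eq_norm_sq] at h1 h2
    linarith
  have h5 := mul_le_mul_of_nonneg_left h4 (mul_nonneg hCf ha)
  have h6 : 0 ≤ μ / 2 * ‖y + (σ * k ^ 2) • w‖ ^ 2 := by positivity
  rw [norm_add_sq_real, inner_smul_right, norm_smul, Real.norm_eq_abs, mul_pow, sq_abs,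
    real_inner_comm] at h6
  rw [norm_smul, Real.norm_eq_abs, mul_pow, sq_abs]
  rw [hA] at h5 ⊢
  linarith

/-- At least `k / 2` coordinates of `x` vanish, while those of the minimizer have size at least `σ *
k / 2`. -/
theorem chainProblem_dist_sq {T : ℕ} (hk : 0 < k) (hσ : 0 < σ) (hT : 2 * T ≤ k)
    {x : EuclideanSpace ℝ (Fin k)} (hx : x ∈ headSpace k T) :
    σ ^ 2 * k ^ 3 / 8 ≤ ‖x - -(σ * k ^ 2) • chainWeights k‖ ^ 2 := by
  have hk' : (0 : ℝ) < k := by exact_mod_cast hk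
  have hcard : ∑ j : Fin k, (if T ≤ (j : ℕ) then (1 : ℝ) else 0) = k - T := by
    rw [Fin.sum_univ_eq_sum_range (fun j => if T ≤ j then (1 : ℝ) else 0) k, Finset.sum_boole]
    have : (Finset.range k).filter (fun j => T ≤ j) = Finset.Ico T k := by
      ext j; simp; omega
    rw [this, Nat.card_Ico, Nat.cast_sub (by omega)]
  have hT' : 2 * (T : ℝ) ≤ k := by exact_mod_cast hT
  calc σ ^ 2 * k ^ 3 / 8 ≤ (σ * k / 2) ^ 2 * (k - T) := by
        have : (k : ℝ) / 2 ≤ k - T := by linarith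
        have := mul_le_mul_of_nonneg_left this (sq_nonneg (σ * k / 2))
        linarith
    _ = ∑ j : Fin k, (σ * k / 2) ^ 2 * (if T ≤ (j : ℕ) then (1 : ℝ) else 0) := by
        rw [← Finset.mul_sum, hcard]
    _ ≤ ‖x - -(σ * k ^ 2) • chainWeights k‖ ^ 2 := by
        rw [EuclideanSpace.norm_sq_eq]
        refine Finset.sum_le_sum fun j _ => ?_
        split_ifs with hj
        · have h1 := hx j hj
          have h2 := le_chainWeights hk j
          have h3 : σ * k / 2 ≤ σ * k ^ 2 * chainWeights k j := by
            have := mul_le_mul_of_nonneg_left h2 (by positivity : 0 ≤ σ * (k : ℝ) ^ 2)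
            refine le_trans (le_of_eq ?_) this
            field_simp
          rw [mul_one, PiLp.sub_apply, h1, PiLp.smul_apply, smul_eq_mul, zero_sub, neg_mul, neg_neg,
            Real.norm_eq_abs, sq_abs]
          exact pow_le_pow_left₀ (by positivity) h3 2
        · rw [mul_zero]; positivity

theorem chainProblem_needsCalls {S : ℕ} {ε : ℝ} (hk : 0 < k) (hσ : 0 < σ) (hμ : 0 < μ)
    (hε : ε < μ / 2 * (σ ^ 2 * k ^ 3 / 8)) :
    NeedsCalls.{u} (chainProblem n k Cf a μ σ) S Set.univ
      (fun x => μ / 2 * ‖x - -(σ * k ^ 2) • chainWeights k‖ ^ 2) ε (S * (k / 2)) := by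
  intro τ η ψ hτ hη Ω _ Pr _ s T xbar _ hmem hexp
  have hk' : (0 : ℝ) < k := by exact_mod_cast hk
  refine mul_le_mul_of_nonneg_left ?_ (Nat.cast_nonneg S)
  by_contra! hlt
  have hT : 2 * T ≤ k := by
    have : 2 * (T : ℝ) ≤ k := by linarith
    exact_mod_cast this
  refine absurd hexp (not_le.2 ?_)
  calc ENNReal.ofReal ε < ENNReal.ofReal (μ / 2 * (σ ^ 2 * k ^ 3 / 8)) :=
        (ENNReal.ofReal_lt_ofReal_iff (by positivity)).2 hε
    _ = ∫⁻ _, ENNReal.ofReal (μ / 2 * (σ ^ 2 * k ^ 3 / 8)) ∂Pr := by simp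
    _ ≤ _ := by
        refine lintegral_mono_ae ?_
        filter_upwards [hmem] with ω hω
        refine ENNReal.ofReal_le_ofReal (mul_le_mul_of_nonneg_left ?_ (by positivity))
        exact chainProblem_dist_sq hk hσ hT ((chainProblem_primal_le hk hσ hμ.le hη _ _ _ T).2 hω.1)

end chain

/-! ### Parameters of the chain instance. -/

theorem NeedsCalls.mono {n d : ℕ} {p : CFCCO n d} {S : ℕ} {D : Set (EuclideanSpace ℝ (Fin d))}
    {loss : EuclideanSpace ℝ (Fin d) → ℝ} {ε N N' : ℝ} (h : NeedsCalls.{u} p S D loss ε N)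
    (hN : N' ≤ N) : NeedsCalls.{u} p S D loss ε N' :=
  fun τ η ψ hτ hη Ω _ Pr _ s T xbar hx hmem hexp =>
    hN.trans (h τ η ψ hτ hη Ω Pr s T xbar hx hmem hexp)

theorem OuterSmooth.mono {f : ℝ → ℝ} {L L' : ℝ} (h : OuterSmooth f L) (hL : L ≤ L') :
    OuterSmooth f L' :=
  ⟨h.1, fun u v => (h.2 u v).trans (by gcongr)⟩

/-- The hard instance with a deterministic chain. -/
theorem exists_chain_instance {Cf Cg σ0 σ1 δ a : ℝ} (hCf : 0 < Cf) (ha : 0 < a) (haCg : a ≤ Cg)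
    (haδ : Cf * a ≤ δ) {n S : ℕ} {μ Lf ε : ℝ} (hn : 0 < n) (hμ : 0 < μ) (hLf : 0 ≤ Lf)
    (hε : 0 < ε) (hεμ : ε * μ ≤ (Cf * a) ^ 2 / 32) :
    ∃ (d : ℕ) (p : CFCCO n d) (xs : EuclideanSpace ℝ (Fin d)),
      p.InClass Cf Cg σ0 σ1 δ μ ∧ (∀ i, OuterSmooth (p.f i) Lf) ∧ p.IsMinimizer xs ∧
      NeedsCalls.{u} p S Set.univ (fun x => μ / 2 * ‖x - xs‖ ^ 2) ε
        ((Cf * a) ^ 2 / 128 * ((S : ℝ) / μ) * ε⁻¹) := by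
  set A := Cf * a with hA
  have hA0 : 0 < A := mul_pos hCf ha
  -- `σ` below is dictated by stationarity; the loss bound then becomes `A ^ 2 / (16 * μ * k)`,
  -- which is at least `2 * ε` when `k ≤ R`. Since `R ≥ 1`, rounding down loses at most a factor
  -- two.
  set R : ℝ := A ^ 2 / (32 * μ * ε) with hR
  have hR1 : 1 ≤ R := by
    rw [hR, le_div_iff₀ (by positivity)]; linarith
  set k := ⌊R⌋₊ with hk
  have hk1 : 1 ≤ k := Nat.le_floor (by simpa using hR1)
  have hk1' : (1 : ℝ) ≤ k := by exact_mod_cast hk1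
  have hkR : (k : ℝ) ≤ R := Nat.floor_le (by linarith)
  have hRk : R < k + 1 := Nat.lt_floor_add_one R
  set σ := A / (μ * k ^ 2) with hσ
  have hσ0 : 0 < σ := by positivity
  refine ⟨k, chainProblem n k Cf a μ σ, -(σ * k ^ 2) • chainWeights k,
    chainProblem_inClass hn hk1 hσ0 hCf.le ha.le haCg haδ,
    chainProblem_outerSmooth hLf,
    chainProblem_isMinimizer hn hk1 hσ0 hCf.le ha.le hμ.le (by rw [hσ]; field_simp; rfl),
    (chainProblem_needsCalls hk1 hσ0 hμ ?_).mono ?_⟩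
  · have e : μ / 2 * (σ ^ 2 * k ^ 3 / 8) = A ^ 2 / (16 * μ * k) := by
      rw [hσ]; field_simp; norm_num
    rw [e, lt_div_iff₀ (by positivity)]
    rw [hR, le_div_iff₀ (by positivity)] at hkR
    nlinarith [pow_pos hA0 2]
  · have e : A ^ 2 / 128 * ((S : ℝ) / μ) * ε⁻¹ = S * (R / 4) := by
      rw [hR]; field_simp; ring
    rw [e]
    refine mul_le_mul_of_nonneg_left ?_ (Nat.cast_nonneg S)
    linarith

/-! ### The pseudo-Huber function. -/

/-- With `b`, `c` the two roots, the gap is `(b * c - (1 + s * t)) / c`. Cauchy–Schwarz gives the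
lower bound, `2 * b * c ≤ b ^ 2 + c ^ 2` and `c ≥ 1` the upper one. -/
theorem sqrt_one_add_sq_tangent (s t : ℝ) :
    0 ≤ √(1 + s ^ 2) - √(1 + t ^ 2) - t / √(1 + t ^ 2) * (s - t) ∧
      √(1 + s ^ 2) - √(1 + t ^ 2) - t / √(1 + t ^ 2) * (s - t) ≤ (s - t) ^ 2 / 2 := by
  have hs := Real.sq_sqrt (show 0 ≤ 1 + s ^ 2 by positivity)
  have ht := Real.sq_sqrt (show 0 ≤ 1 + t ^ 2 by positivity)
  have hs1 : 1 ≤ √(1 + s ^ 2) := Real.one_le_sqrt.2 (by nlinarith)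
  have ht1 : 1 ≤ √(1 + t ^ 2) := Real.one_le_sqrt.2 (by nlinarith)
  set b := √(1 + s ^ 2)
  set c := √(1 + t ^ 2)
  have hc : 0 < c := by linarith
  have e : b - c - t / c * (s - t) = (b * c - (1 + s * t)) / c := by
    field_simp
    linear_combination -ht
  have hcs : 1 + s * t ≤ b * c := by
    refine le_of_sq_le_sq ?_ (by positivity)
    rw [mul_pow, hs, ht]
    nlinarith [sq_nonneg (s - t)]
  rw [e]
  refine ⟨div_nonneg (by linarith) hc.le, ?_⟩
  rw [div_le_iff₀ hc]
  have h1 : b * c - (1 + s * t) ≤ (s - t) ^ 2 / 2 := by nlinarith [sq_nonneg (b - c)]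
  have h2 : (s - t) ^ 2 / 2 ≤ (s - t) ^ 2 / 2 * c := le_mul_of_one_le_right (by positivity) ht1
  linarith

/-- The pseudo-Huber function, with slopes in `[-C, C]` and curvature `L` at the origin. -/
noncomputable def pseudoHuber (C L u : ℝ) : ℝ := C ^ 2 / L * (√(1 + (L * u / C) ^ 2) - 1)

/-- The derivative of the pseudo-Huber function. -/
noncomputable def pseudoHuberDeriv (C L u : ℝ) : ℝ :=
  C * ((L * u / C) / √(1 + (L * u / C) ^ 2))

section pseudoHuber

variable {C L : ℝ}

theorem pseudoHuber_tangent (hC : 0 < C) (hL : 0 < L) (u v : ℝ) :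
    0 ≤ pseudoHuber C L u - pseudoHuber C L v - pseudoHuberDeriv C L v * (u - v) ∧
      pseudoHuber C L u - pseudoHuber C L v - pseudoHuberDeriv C L v * (u - v)
        ≤ L / 2 * (u - v) ^ 2 := by
  obtain ⟨h1, h2⟩ := sqrt_one_add_sq_tangent (L * u / C) (L * v / C)
  have hCL : 0 < C ^ 2 / L := by positivity
  have e : pseudoHuber C L u - pseudoHuber C L v - pseudoHuberDeriv C L v * (u - v)
      = C ^ 2 / L * (√(1 + (L * u / C) ^ 2) - √(1 + (L * v / C) ^ 2)
        - L * v / C / √(1 + (L * v / C) ^ 2) * (L * u / C - L * v / C)) := by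
    unfold pseudoHuber pseudoHuberDeriv
    generalize √(1 + (L * u / C) ^ 2) = b
    generalize L * v / C / √(1 + (L * v / C) ^ 2) = θ
    field_simp
    ring
  rw [e]
  refine ⟨mul_nonneg hCL.le h1, (mul_le_mul_of_nonneg_left h2 hCL.le).trans (le_of_eq ?_)⟩
  field_simp

theorem pseudoHuber_nonneg (hL : 0 < L) (u : ℝ) : 0 ≤ pseudoHuber C L u :=
  mul_nonneg (by positivity)
    (sub_nonneg.2 (Real.one_le_sqrt.2 (by nlinarith [sq_nonneg (L * u / C)])))

theorem pseudoHuber_zero : pseudoHuber C L 0 = 0 := by simp [pseudoHuber]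

theorem hasDerivAt_pseudoHuber (hC : 0 < C) (hL : 0 < L) (v : ℝ) :
    HasDerivAt (pseudoHuber C L) (pseudoHuberDeriv C L v) v := by
  have h : HasGradientAt (pseudoHuber C L) (pseudoHuberDeriv C L v) v := by
    refine hasGradientAt_of_quadratic_bound (L / 2) fun u => ?_
    have hi : inner ℝ (pseudoHuberDeriv C L v) (u - v) = pseudoHuberDeriv C L v * (u - v) := by
      simp [mul_comm]
    obtain ⟨h1, h2⟩ := pseudoHuber_tangent hC hL u v
    rw [hi, abs_of_nonneg h1, Real.norm_eq_abs, sq_abs]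
    exact h2
  simpa using h.hasDerivAt

theorem abs_pseudoHuberDeriv_le (hC : 0 < C) (v : ℝ) : |pseudoHuberDeriv C L v| ≤ C := by
  unfold pseudoHuberDeriv
  rw [abs_mul, abs_of_pos hC, abs_div, abs_of_nonneg (Real.sqrt_nonneg _)]
  refine mul_le_of_le_one_right hC.le (div_le_one_of_le₀ ?_ (Real.sqrt_nonneg _))
  exact Real.abs_le_sqrt (by linarith)

theorem pseudoHuber_lipschitz (hC : 0 < C) (hL : 0 < L) (u v : ℝ) :
    |pseudoHuber C L u - pseudoHuber C L v| ≤ C * |u - v| := by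
  have key : ∀ u v, pseudoHuber C L u - pseudoHuber C L v ≤ C * |u - v| := by
    intro u v
    have h := (pseudoHuber_tangent hC hL v u).1
    have h1 : |pseudoHuberDeriv C L u * (u - v)| ≤ C * |u - v| := by
      rw [abs_mul]
      exact mul_le_mul_of_nonneg_right (abs_pseudoHuberDeriv_le hC u) (abs_nonneg _)
    have h2 := le_abs_self (pseudoHuberDeriv C L u * (u - v))
    nlinarith
  refine abs_le.2 ⟨?_, key u v⟩
  have := key v u
  rw [abs_sub_comm] at this
  linarith

theorem convexOn_pseudoHuber (hC : 0 < C) (hL : 0 < L) :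
    ConvexOn ℝ Set.univ (pseudoHuber C L) :=
  convexOn_univ_of_subgradient (fun v => pseudoHuberDeriv C L v • LinearMap.id) fun v u => by
    have := (pseudoHuber_tangent hC hL u v).1
    simp only [LinearMap.smul_apply, LinearMap.id_apply, smul_eq_mul]
    linarith

theorem outerSmooth_pseudoHuber (hC : 0 < C) (hL : 0 < L) : OuterSmooth (pseudoHuber C L) L := by
  refine ⟨fun v => (hasDerivAt_pseudoHuber hC hL v).differentiableAt, fun u v => ?_⟩
  rw [(hasDerivAt_pseudoHuber hC hL v).deriv, abs_of_nonneg (pseudoHuber_tangent hC hL u v).1]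
  exact (pseudoHuber_tangent hC hL u v).2

/-- For `L * w ≤ C` the root in the denominator lies between `1` and `√2`, so the slope is still
comparable to `L * w`. -/
theorem pseudoHuberDeriv_bounds (hC : 0 < C) (hL : 0 < L) {w : ℝ} (hw : 0 ≤ w)
    (hLw : L * w ≤ C) : 0 ≤ pseudoHuberDeriv C L w ∧ pseudoHuberDeriv C L w ≤ L * w ∧
      (L * w) ^ 2 / 2 ≤ pseudoHuberDeriv C L w ^ 2 := by
  have e : pseudoHuberDeriv C L w = L * w / √(1 + (L * w / C) ^ 2) := by
    unfold pseudoHuberDeriv; field_simp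
  have h0 : 0 ≤ L * w := by positivity
  have h1 : 1 ≤ √(1 + (L * w / C) ^ 2) :=
    Real.one_le_sqrt.2 (by nlinarith [sq_nonneg (L * w / C)])
  rw [e]
  refine ⟨by positivity, div_le_self h0 h1, ?_⟩
  rw [div_pow, Real.sq_sqrt (by positivity)]
  have h2 : L * w / C ≤ 1 := div_le_one_of_le₀ hLw hC.le
  have h3 : 0 ≤ L * w / C := by positivity
  gcongr
  nlinarith

end pseudoHuber

/-! ### Parameters of the rare-observation instances. -/

/-- The hard instance with rarely observed inner values and smooth outer functions. -/
theorem exists_sparse_smooth_instance {Cf Cg σ0 σ1 δ a : ℝ} (hCf : 0 < Cf) (hσ0 : 0 < σ0)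
    (ha : 0 < a) (haCg : a ≤ Cg) (haδ : Cf * a ≤ δ) {n S : ℕ} {μ Lf ε : ℝ} (hn : 0 < n)
    (hμ : 0 < μ) (hLf : 0 < Lf) (hε : 0 < ε) (hν1 : 1 ≤ n * μ) (hνL : n * μ ≤ Lf ^ 2)
    (hεσ : ε ≤ a ^ 2 * σ0 ^ 2 / (8 * (1 + a ^ 2) ^ 2)) (hεν : ε * (n * μ) ≤ a ^ 2 * Cf ^ 2 / 8) :
    ∃ (d : ℕ) (p : CFCCO n d) (xs : EuclideanSpace ℝ (Fin d)),
      p.InClass Cf Cg σ0 σ1 δ μ ∧ (∀ i, OuterSmooth (p.f i) Lf) ∧ p.IsMinimizer xs ∧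
      NeedsCalls.{u} p S Set.univ (fun x => μ / 2 * ‖x - xs‖ ^ 2) ε
        (a ^ 2 * σ0 ^ 2 / (16 * (1 + a ^ 2) ^ 2) * n * ε⁻¹) := by
  have hn' : (0 : ℝ) < n := by exact_mod_cast hn
  set ν := (n : ℝ) * μ with hν
  have hν0 : 0 < ν := by positivity
  -- With `L ^ 2 = ν` the block loss `ν / 2 * v ^ 2` is of order `(a * w) ^ 2` independently of `ν`,
  -- and `L ≥ 1` keeps `m` of order `w`.
  set L := √ν with hL
  have hL1 : 1 ≤ L := Real.one_le_sqrt.2 hν1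
  have hL0 : 0 < L := by linarith
  have hL2 : L ^ 2 = ν := Real.sq_sqrt hν0.le
  have hLLf : L ≤ Lf := Real.sqrt_le_left hLf.le |>.2 hνL
  set w := √(8 * ε) / a with hw
  have hw0 : 0 < w := by positivity
  have hw2 : w ^ 2 = 8 * ε / a ^ 2 := by rw [hw, div_pow, Real.sq_sqrt (by positivity)]
  have hLw : L * w ≤ Cf := by
    refine le_of_sq_le_sq ?_ hCf.le
    rw [mul_pow, hL2, hw2, mul_div_assoc', div_le_iff₀ (by positivity)]
    linarith
  obtain ⟨hθ0, hθ1, hθ2⟩ := pseudoHuberDeriv_bounds hCf hL0 hw0.le hLw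
  set θ := pseudoHuberDeriv Cf L w
  -- `v` solves the stationarity equation of a block whose optimal inner value is `w`, `m` realizes
  -- that value, and `q` makes the variance bound tight for the estimate `m ≤ (1 + a ^ 2) * w`.
  set v := -(a * θ / ν) with hv
  set m := w - a * v with hm
  set q := 8 * (1 + a ^ 2) ^ 2 * ε / (a ^ 2 * σ0 ^ 2) with hq
  have hq0 : 0 < q := by positivity
  have hq1 : q ≤ 1 := by
    rw [le_div_iff₀ (by positivity)] at hεσ
    rw [hq, div_le_one (by positivity)]
    linarith
  have hmw : m ≤ (1 + a ^ 2) * w := by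
    have h1 : θ / ν ≤ w := by
      rw [div_le_iff₀ hν0, ← hL2]
      nlinarith [mul_pos hL0 hw0]
    have h2 : m = w + a ^ 2 * (θ / ν) := by rw [hm, hv]; ring
    rw [h2]
    nlinarith [sq_nonneg a]
  have hm0 : 0 ≤ m := by
    have h2 : m = w + a ^ 2 * (θ / ν) := by rw [hm, hv]; ring
    rw [h2]; positivity
  have hmq : m ^ 2 ≤ q * σ0 ^ 2 := by
    refine (pow_le_pow_left₀ hm0 hmw 2).trans (le_of_eq ?_)
    rw [mul_pow, hw2, hq]
    field_simp
  have hℓ : 2 * ε ≤ ν / 2 * v ^ 2 := by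
    have h1 : ν / 2 * v ^ 2 = a ^ 2 / (2 * ν) * θ ^ 2 := by rw [hv]; field_simp
    have h2 : a ^ 2 / (2 * ν) * ((L * w) ^ 2 / 2) = 2 * ε := by
      rw [mul_pow, hL2, hw2]; field_simp; norm_num
    rw [h1, ← h2]
    exact mul_le_mul_of_nonneg_left hθ2 (by positivity)
  refine ⟨n, sparseProblem n (pseudoHuber Cf L) a m q μ, WithLp.toLp 2 fun _ => v,
    sparseProblem_inClass hn hCf.le ha.le haCg haδ hq0 hq1 hmq (convexOn_pseudoHuber hCf hL0)
      (pseudoHuber_lipschitz hCf hL0),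
    fun _ => (outerSmooth_pseudoHuber hCf hL0).mono hLLf,
    sparseProblem_isMinimizer (w := w) (θ := θ) hn hq0 hq1 hμ.le ?_ (by rw [hm]; ring) ?_,
    (sparseProblem_needsCalls hn hμ.le hq0 (pseudoHuber_nonneg hL0) pseudoHuber_zero hε hℓ
      ?_).mono (le_of_eq ?_)⟩
  · intro u
    have := (pseudoHuber_tangent hCf hL0 u w).1
    linarith
  · rw [hv, ← hν]; field_simp; ring
  · intro x
    have e : ν / 2 * v ^ 2 / n = μ / 2 * v ^ 2 := by rw [hν]; field_simp
    rw [e, mul_assoc]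
    refine mul_le_mul_of_nonneg_left ?_ (by positivity)
    rw [EuclideanSpace.norm_sq_eq, Finset.mul_sum]
    refine Finset.sum_le_sum fun i _ => ?_
    split_ifs with hi
    · simp [hi]
    · rw [mul_zero]; positivity
  · rw [hq]; field_simp; norm_num

theorem not_differentiable_mul_max_zero {C : ℝ} (hC : 0 < C) :
    ¬ Differentiable ℝ fun u : ℝ => C * max u 0 := by
  intro h
  refine not_differentiableAt_abs_zero ?_
  have e : (fun u : ℝ => |u|) = fun u => 2 * C⁻¹ * (C * max u 0) - u := by
    funext u
    have : 2 * C⁻¹ * (C * max u 0) = 2 * max u 0 := by field_simp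
    rw [this]
    rcases le_total u 0 with hu | hu
    · rw [abs_of_nonpos hu, max_eq_right hu]; ring
    · rw [abs_of_nonneg hu, max_eq_left hu]; ring
  change DifferentiableAt ℝ (fun u : ℝ => |u|) 0
  rw [e]
  exact ((h 0).const_mul _).sub differentiableAt_id

/-- The hard instance with rarely observed inner values and non-smooth outer functions. -/
theorem exists_sparse_nonsmooth_instance {Cf Cg σ0 σ1 δ a : ℝ} (hCf : 0 < Cf) (hσ0 : 0 < σ0)
    (ha : 0 < a) (haCg : a ≤ Cg) (haδ : Cf * a ≤ δ) {n S : ℕ} {μ ε : ℝ} (hn : 0 < n)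
    (hμ : 0 ≤ μ) (hε : 0 < ε) (hεσ : ε ≤ Cf * σ0 / 4)
    (hεν : ε * (n * μ) ≤ a ^ 2 * Cf ^ 2 / 8) :
    ∃ (d : ℕ) (p : CFCCO n d) (xs : EuclideanSpace ℝ (Fin d)),
      p.InClass Cf Cg σ0 σ1 δ μ ∧ (∀ i, ¬ Differentiable ℝ (p.f i)) ∧ p.IsMinimizer xs ∧
      NeedsCalls.{u} p S p.X (fun x => p.F x - p.F xs) ε
        (Cf ^ 2 * σ0 ^ 2 / 32 * n * (ε ^ 2)⁻¹) := by
  have hn' : (0 : ℝ) < n := by exact_mod_cast hn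
  set ν := (n : ℝ) * μ with hν
  have hν0 : 0 ≤ ν := by positivity
  -- The minimizer sits at the kink. A block left at zero pays `Cf * m = 4 * ε`, of which the
  -- regularizer at `v` returns `θ * m / 2 ≤ 2 * ε`, so the gap is at least `2 * ε`.
  set m := 4 * ε / Cf with hm
  have hm0 : 0 < m := by positivity
  have hCm : Cf * m = 4 * ε := by rw [hm]; field_simp
  set v := -(m / a) with hv
  have hav : a * v + m = 0 := by rw [hv]; field_simp; ring
  set θ := ν * m / a ^ 2 with hθ
  have hθ0 : 0 ≤ θ := by positivity
  have hθ1 : θ ≤ Cf := by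
    rw [hθ, div_le_iff₀ (by positivity), hm, mul_div_assoc', div_le_iff₀ hCf]
    nlinarith
  set q := 16 * ε ^ 2 / (Cf ^ 2 * σ0 ^ 2) with hq
  have hq0 : 0 < q := by positivity
  have hq1 : q ≤ 1 := by
    rw [hq, div_le_one (by positivity)]
    have := pow_le_pow_left₀ hε.le hεσ 2
    -- Squaring `hεσ` gives exactly the condition `q ≤ 1`.
    linarith
  have hsub : ∀ u, Cf * max 0 0 + θ * (u - 0) ≤ Cf * max u 0 := by
    intro u
    rw [max_self, mul_zero, zero_add, sub_zero]
    rcases le_total u 0 with hu | hu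
    · rw [max_eq_right hu]; nlinarith
    · rw [max_eq_left hu]; nlinarith
  have hopt : a * θ + ν * v = 0 := by rw [hθ, hv]; field_simp; ring
  have hconv : ConvexOn ℝ Set.univ fun u : ℝ => Cf * max u 0 :=
    ((convexOn_id convex_univ).sup (convexOn_const (0 : ℝ) convex_univ)).smul hCf.le
  refine ⟨n, sparseProblem n (fun u => Cf * max u 0) a m q μ, WithLp.toLp 2 fun _ => v,
    sparseProblem_inClass hn hCf.le ha.le haCg haδ hq0 hq1 (le_of_eq ?_) hconv ?_,
    fun _ => not_differentiable_mul_max_zero hCf,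
    sparseProblem_isMinimizer (w := 0) (θ := θ) hn hq0 hq1 hμ hsub hav.symm hopt,
    (sparseProblem_needsCalls (ℓ := 2 * ε) hn hμ hq0 (fun u => by positivity) (by simp) hε le_rfl
      ?_).mono (le_of_eq ?_)⟩
  · rw [hq, hm]; field_simp; norm_num
  · intro u u'
    rw [← mul_sub, abs_mul, abs_of_pos hCf]
    exact mul_le_mul_of_nonneg_left (abs_max_sub_max_le_abs u u' 0) hCf.le
  · intro x
    rw [sparseProblem_F hn hq0 hq1, sparseProblem_F hn hq0 hq1, ← mul_sub,
      ← Finset.sum_sub_distrib, div_eq_mul_one_div, mul_comm (2 * ε), mul_assoc]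
    refine mul_le_mul_of_nonneg_left ?_ (by positivity)
    rw [Finset.mul_sum]
    refine Finset.sum_le_sum fun i _ => ?_
    have hle := sparseProblem_scalar_le (f := fun u => Cf * max u 0) hν0 hsub hav.symm hopt (x i)
    split_ifs with hi
    · change 2 * ε * 1 ≤ Cf * max (a * x i + m) 0 + ν / 2 * x i ^ 2
        - (Cf * max (a * v + m) 0 + ν / 2 * v ^ 2)
      rw [hi, hav, mul_zero, zero_add, max_eq_left hm0.le, max_self]
      have h1 : ν / 2 * v ^ 2 = θ * m / 2 := by rw [hv, hθ]; ring
      rw [h1]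
      nlinarith
    · rw [mul_zero]
      exact sub_nonneg.2 hle
  · rw [hq]; field_simp; norm_num

/-! ### Choice of constants and of the instance. -/

theorem theorem4 (Cf Cg σ0 σ1 δ : ℝ) (hCf : 0 < Cf) (hCg : 0 < Cg) (hσ0 : 0 < σ0)
    (hσ1 : 0 ≤ σ1) (hδ : 0 < δ) :
    ∃ c : ℝ, 0 < c ∧
      -- smooth outer functions, strongly convex problems
      (∀ (n S : ℕ) (μ Lf ε : ℝ), 1 ≤ S → S ≤ n → 0 < μ → 0 < Lf → 0 < ε →
        (n : ℝ) * μ ≤ max 1 (Lf ^ 2) → ε * (1 + (n : ℝ) * μ) ≤ c →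
        ∃ (d : ℕ) (p : CFCCO n d) (xs : EuclideanSpace ℝ (Fin d)),
          p.InClass Cf Cg σ0 σ1 δ μ ∧ (∀ i, OuterSmooth (p.f i) Lf) ∧ p.IsMinimizer xs ∧
          NeedsCalls.{u} p S Set.univ (fun x => μ / 2 * ‖x - xs‖ ^ 2) ε
            (c * max ((S : ℝ) / μ) (n : ℝ) * ε⁻¹)) ∧
      -- the first term of the maximum, without the restriction on `n * μ`
      (∀ (n S : ℕ) (μ Lf ε : ℝ), 1 ≤ S → S ≤ n → 0 < μ → 0 < Lf → 0 < ε → ε * μ ≤ c →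
        ∃ (d : ℕ) (p : CFCCO n d) (xs : EuclideanSpace ℝ (Fin d)),
          p.InClass Cf Cg σ0 σ1 δ μ ∧ (∀ i, OuterSmooth (p.f i) Lf) ∧ p.IsMinimizer xs ∧
          NeedsCalls.{u} p S Set.univ (fun x => μ / 2 * ‖x - xs‖ ^ 2) ε
            (c * ((S : ℝ) / μ) * ε⁻¹)) ∧
      -- non-smooth outer functions, merely (`μ = 0`) or strongly (`μ > 0`) convex problems
      (∀ (n S : ℕ) (μ ε : ℝ), 1 ≤ S → S ≤ n → 0 ≤ μ → 0 < ε → ε * (1 + (n : ℝ) * μ) ≤ c →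
        ∃ (d : ℕ) (p : CFCCO n d) (xs : EuclideanSpace ℝ (Fin d)),
          p.InClass Cf Cg σ0 σ1 δ μ ∧ (∀ i, ¬ Differentiable ℝ (p.f i)) ∧ p.IsMinimizer xs ∧
          NeedsCalls.{u} p S p.X (fun x => p.F x - p.F xs) ε
            (c * (n : ℝ) * (ε ^ 2)⁻¹)) := by
  obtain ⟨a, ha, haCg, haδ⟩ : ∃ a, 0 < a ∧ a ≤ Cg ∧ Cf * a ≤ δ := by
    refine ⟨min Cg (δ / Cf), by positivity, min_le_left _ _, ?_⟩
    rw [mul_comm, ← le_div_iff₀ hCf]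
    exact min_le_right _ _
  obtain ⟨c, hc, hc1, hc2, hc3, hc4, hc5⟩ : ∃ c : ℝ, 0 < c ∧ c ≤ (Cf * a) ^ 2 / 128 ∧
      c ≤ a ^ 2 * σ0 ^ 2 / (16 * (1 + a ^ 2) ^ 2) ∧ c ≤ a ^ 2 * Cf ^ 2 / 8 ∧
      c ≤ Cf * σ0 / 4 ∧ c ≤ Cf ^ 2 * σ0 ^ 2 / 32 := by
    refine ⟨min ((Cf * a) ^ 2 / 128) (min (a ^ 2 * σ0 ^ 2 / (16 * (1 + a ^ 2) ^ 2))
      (min (a ^ 2 * Cf ^ 2 / 8) (min (Cf * σ0 / 4) (Cf ^ 2 * σ0 ^ 2 / 32)))), by positivity, ?_⟩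
    simp only [min_le_iff, le_refl, true_or, or_true, and_self]
  have chain : ∀ (n S : ℕ) (μ Lf ε : ℝ), 1 ≤ S → S ≤ n → 0 < μ → 0 < Lf → 0 < ε → ε * μ ≤ c →
        ∃ (d : ℕ) (p : CFCCO n d) (xs : EuclideanSpace ℝ (Fin d)),
          p.InClass Cf Cg σ0 σ1 δ μ ∧ (∀ i, OuterSmooth (p.f i) Lf) ∧ p.IsMinimizer xs ∧
          NeedsCalls.{u} p S Set.univ (fun x => μ / 2 * ‖x - xs‖ ^ 2) ε
            (c * ((S : ℝ) / μ) * ε⁻¹) := by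
    intro n S μ Lf ε hS hSn hμ hLf hε hεμ
    obtain ⟨d, p, xs, h1, h2, h3, h4⟩ := exists_chain_instance (σ0 := σ0) (σ1 := σ1) (S := S)
      hCf ha haCg haδ (by omega : 0 < n) hμ hLf.le hε (by nlinarith [mul_pos hCf ha])
    exact ⟨d, p, xs, h1, h2, h3, h4.mono (by gcongr)⟩
  refine ⟨c, hc, ?_, chain, ?_⟩
  · intro n S μ Lf ε hS hSn hμ hLf hε hnμ hεc
    have hn' : (1 : ℝ) ≤ n := by exact_mod_cast hS.trans hSn
    have hS' : (1 : ℝ) ≤ S := by exact_mod_cast hS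
    have hν : 0 < ε * ((n : ℝ) * μ) := by positivity
    have hεμ : ε * μ ≤ ε * (n * μ) :=
      mul_le_mul_of_nonneg_left (le_mul_of_one_le_left hμ.le hn') hε.le
    rw [mul_add, mul_one] at hεc
    -- The larger term of the maximum selects the instance. If it is `n`, then `n * μ > S ≥ 1`, so
    -- the bound on `n * μ` must come from `Lf ^ 2`, as the pseudo-Huber instance requires.
    rcases le_or_gt (n : ℝ) (S / μ) with h | h
    · rw [max_eq_left h]
      exact chain n S μ Lf ε hS hSn hμ hLf hε (by linarith)
    · rw [max_eq_right h.le]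
      rw [div_lt_iff₀ hμ] at h
      have hνL : (n : ℝ) * μ ≤ Lf ^ 2 := by
        rcases le_max_iff.1 hnμ with h' | h'
        · linarith
        · exact h'
      have hεσ : ε ≤ a ^ 2 * σ0 ^ 2 / (8 * (1 + a ^ 2) ^ 2) := by
        have : a ^ 2 * σ0 ^ 2 / (16 * (1 + a ^ 2) ^ 2) ≤ a ^ 2 * σ0 ^ 2 / (8 * (1 + a ^ 2) ^ 2) := by
          gcongr
          norm_num
        linarith
      obtain ⟨d, p, xs, h1, h2, h3, h4⟩ := exists_sparse_smooth_instance (σ1 := σ1) (S := S)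
        hCf hσ0 ha haCg haδ (by omega : 0 < n) hμ hLf hε (by linarith) hνL hεσ (by linarith)
      exact ⟨d, p, xs, h1, h2, h3, h4.mono (by gcongr)⟩
  · intro n S μ ε hS hSn hμ hε hεc
    have hν : 0 ≤ ε * ((n : ℝ) * μ) := by positivity
    rw [mul_add, mul_one] at hεc
    obtain ⟨d, p, xs, h1, h2, h3, h4⟩ := exists_sparse_nonsmooth_instance (σ1 := σ1) (S := S)
      hCf hσ0 ha haCg haδ (by omega : 0 < n) hμ hε (by linarith) (by linarith)
    exact ⟨d, p, xs, h1, h2, h3, h4.mono (by gcongr)⟩
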